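/- Let $\mathcal R,\mathcal Z,\mathcal X,\hat{\mathcal R}$ be finite sets, $p(r,z,x)$ a joint probability mass function, $d:\hat{\mathcal R}\times\mathcal R\to[0,\infty)$, $\mu_1,\mu_2\ge 0$ with $\mu_1+\mu_2>0$, and $\epsilon,\delta\in\mathbb R$. Logarithms are to base $2$. For a channel $p=\{p(\hat r\mid z,x)\}$, with $\hat R-(Z,X)-R$ a Markov chain, put $$g(p)=\mathbb E[d(\hat R,R)]+\mu_1\big(I(\hat R;X)-\epsilon\big)+\mu_2\big(I(\hat R,Z;X)-\delta\big).$$ Write $\bar d(\hat r,z,x)=\sum_r p(r\mid z,x)d(\hat r,r)$ and, for conditional distributions $q=(q_1(\hat r),q_2(z\mid\hat r,x),q_3(\hat r\mid z))$, $$f(p;q_1;q_2;q_3)=\sum_{\hat r,z,x}p(\hat r\mid z,x)p(z,x)\log\frac{2^{\bar d(\hat r,z,x)}\,p(\hat r\mid z,x)^{\mu_1+\mu_2}}{q_2(z\mid\hat r,x)^{\mu_1}q_1(\hat r)^{\mu_1}q_3(\hat r\mid z)^{\mu_2}}+\theta,$$ $$\theta=\sum_{z,x}p(z,x)\Big[(\mu_1+\mu_2)\log\frac{p(z,x)}{p(z)p(x)}+\mu_1\log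 p(z)\Big]-\mu_1\epsilon-\mu_2\delta ,$$ where terms of zero weight are $0$. Let $q_1^0,q_2^0,q_3^0$ be (conditional) distributions all of whose entries are positive, and for $t=0,1,2,\dots$ let iteration $t$ compute $$p^t(\hat r\mid z,x)=\tfrac1{\eta_t(z,x)}\Big[q_1^t(\hat r)^{\mu_1}q_2^t(z\mid\hat r,x)^{\mu_1}q_3^t(\hat r\mid z)^{\mu_2}2^{-\bar d(\hat r,z,x)}\Big]^{\frac1{\mu_1+\mu_2}},$$ with $\eta_t(z,x)$ the normalising factor, and then $$q_1^{t+1}(\hat r)=\sum_{z,x}p^t(\hat r\mid z,x)p(z,x),\quad q_2^{t+1}(z\mid\hat r,x)=\frac{p^t(\hat r\mid z,x)p(z\mid x)}{\sum_{z'}p^t(\hat r\mid z',x)p(z'\mid x)},\quad q_3^{t+1}(\hat r\mid z)=\sum_x p^t(\hat r\mid z,x)p(x\mid z).$$ Pairs $(z,x)$ with $p(z,x)=0$ are immaterial; statements about entries of $p^t,q^t,p^\star,p_1$ below are meant at pairs with $p(z,x)>0$. Then: 1. All $p^t,q_1^t,q_2^t,q_3^t$ are (conditional) probability distributions with positive entries.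 2. None of the four update steps increases $f$: $f(p^t;q_1^t;q_2^t;q_3^t)\ge f(p^t;q_1^{t+1};q_2^t;q_3^t)\ge f(p^t;q_1^{t+1};q_2^{t+1};q_3^t)\ge f(p^t;q_1^{t+1};q_2^{t+1};q_3^{t+1})\ge f(p^{t+1};q_1^{t+1};q_2^{t+1};q_3^{t+1})$. In particular $f(p^t;q^t)$ and the value $f(p^t;q^{t+1})$ attained after iteration $t$ are both non-increasing in $t$. For each $t$, either both strictly decrease from $t$ to $t+1$, or the iteration has converged: $p^s=p^t$ and $q^{s+1}=q^{t+1}$ for all $s\ge t$. 3. $g(p)\ge-(\mu_1\epsilon+\mu_2\delta)$ for every channel $p$, and $f(p;q)\ge-(\mu_1\epsilon+\mu_2\delta)$ for every channel $p$ and all (conditional) distributions $q$ such that $q_1(\hat r),q_2(z\mid\hat r,x),q_3(\hat r\mid z)>0$ whenever $p(\hat r\mid z,x)p(z,x)>0$. The values $f(p^t;q^t)$ and $f(p^t;q^{t+1})$ obey the same bound. 4. After each iteration $t$ the variables are consistent: $g(p^t)=f(p^t;q_1^{t+1};q_2^{t+1};q_3^{t+1})$. 5. There is a channel $p^\star$ that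 minimises $g$ over all channels such that, as $T\to\infty$, $g(p^T)\to g(p^\star)=\min_p g(p)$, $f(p^T;q^T)\to g(p^\star)$ and $p^T\to p^\star$, whether or not minimisers lie on the boundary of the simplex. If $g$ has a minimiser $p_1$ over all channels with only positive entries, then $p^\star$ also has only positive entries and it satisfies the self-consistency equation, i.e. it is unchanged when $q_1,q_2,q_3$ are computed from $p^\star$ by the update formulas and $p$ is then recomputed from them. -/

import Mathlib

noncomputable section

namespace DataRelease

/-- Mutual information, in bits, of two finite random variables with joint mass function `J`. -/
def mutualInfo {A B : Type*} [Fintype A] [Fintype B] (J : A → B → ℝ) : ℝ :=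
  ∑ a, ∑ b, J a b * Real.logb 2 (J a b / ((∑ b', J a b') * (∑ a', J a' b)))

/-- The input of the expected-distortion problem: a joint mass function `P r z x` of the request
`R`, the previous releases `Z` and the database `X`, a non-negative distortion function, Lagrange
multipliers that are not both zero, and the two leakage budgets. -/
structure Problem (Rh R Z X : Type*) [Fintype R] [Fintype Z] [Fintype X] where
  P : R → Z → X → ℝ
  P_nonneg : ∀ r z x, 0 ≤ P r z x
  P_sum : ∑ r, ∑ z, ∑ x, P r z x = 1
  d : Rh → R → ℝ
  d_nonneg : ∀ a r, 0 ≤ d a r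
  μ₁ : ℝ
  μ₂ : ℝ
  μ₁_nonneg : 0 ≤ μ₁
  μ₂_nonneg : 0 ≤ μ₂
  μ_pos : 0 < μ₁ + μ₂
  ε : ℝ
  δ : ℝ

/-- A kernel `p z x a`, standing for `p(a | z, x)`, is a channel if each `p z x` is a probability
vector. -/
def IsChannel {Rh Z X : Type*} [Fintype Rh] (p : Z → X → Rh → ℝ) : Prop :=
  ∀ z x, p z x ∈ stdSimplex ℝ Rh

/-- The auxiliary variables: `q₁ a` is `q₁(a)`, `q₂ a x z` is `q₂(z | a, x)` and `q₃ z a` is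
`q₃(a | z)`. -/
structure Aux (Rh Z X : Type*) where
  q₁ : Rh → ℝ
  q₂ : Rh → X → Z → ℝ
  q₃ : Z → Rh → ℝ

/-- The auxiliary variables are (conditional) probability distributions. -/
def Aux.IsDistribution {Rh Z X : Type*} [Fintype Rh] [Fintype Z] (q : Aux Rh Z X) : Prop :=
  q.q₁ ∈ stdSimplex ℝ Rh ∧ (∀ a x, q.q₂ a x ∈ stdSimplex ℝ Z) ∧ ∀ z, q.q₃ z ∈ stdSimplex ℝ Rh

/-- All entries of the auxiliary variables are positive. -/
def Aux.IsPositive {Rh Z X : Type*} (q : Aux Rh Z X) : Prop :=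
  (∀ a, 0 < q.q₁ a) ∧ (∀ a x z, 0 < q.q₂ a x z) ∧ ∀ z a, 0 < q.q₃ z a

namespace Problem

variable {Rh R Z X : Type*} [Fintype Rh] [Fintype R] [Fintype Z] [Fintype X]

/-- `p(z, x)` -/
def pZX (S : Problem Rh R Z X) (z : Z) (x : X) : ℝ := ∑ r, S.P r z x

/-- `p(z)` -/
def pZ (S : Problem Rh R Z X) (z : Z) : ℝ := ∑ x, S.pZX z x

/-- `p(x)` -/
def pX (S : Problem Rh R Z X) (x : X) : ℝ := ∑ z, S.pZX z x

/-- `∑ r, p(r | z, x) d(a, r)` -/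
def dbar (S : Problem Rh R Z X) (a : Rh) (z : Z) (x : X) : ℝ :=
  ∑ r, S.P r z x / S.pZX z x * S.d a r

/-- The expected distortion of the channel `p`, with the release conditionally independent of the
request given `(Z, X)`. -/
def expDistortion (S : Problem Rh R Z X) (p : Z → X → Rh → ℝ) : ℝ :=
  ∑ a, ∑ r, ∑ z, ∑ x, p z x a * S.P r z x * S.d a r

/-- `I(R̂; X)` -/
def leakSingle (S : Problem Rh R Z X) (p : Z → X → Rh → ℝ) : ℝ :=
  mutualInfo fun (a : Rh) (x : X) => ∑ z, p z x a * S.pZX z x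

/-- `I(R̂, Z; X)` -/
def leakJoint (S : Problem Rh R Z X) (p : Z → X → Rh → ℝ) : ℝ :=
  mutualInfo fun (b : Rh × Z) (x : X) => p b.2 x b.1 * S.pZX b.2 x

/-- The Lagrangian objective `g`. -/
def g (S : Problem Rh R Z X) (p : Z → X → Rh → ℝ) : ℝ :=
  S.expDistortion p + S.μ₁ * (S.leakSingle p - S.ε) + S.μ₂ * (S.leakJoint p - S.δ)

/-- The term of `f` that does not depend on `p` and `q`. -/
def θ (S : Problem Rh R Z X) : ℝ :=
  (∑ z, ∑ x, S.pZX z x * ((S.μ₁ + S.μ₂) * Real.logb 2 (S.pZX z x / (S.pZ z * S.pX x))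
    + S.μ₁ * Real.logb 2 (S.pZ z))) - S.μ₁ * S.ε - S.μ₂ * S.δ

/-- The objective `f(p; q₁; q₂; q₃)` with all its arguments treated as independent. A term of zero
weight contributes `0`; where the weight `p(a | z, x) p(z, x)` is positive, the formula is meant for
positive `q₁(a)`, `q₂(z | a, x)`, `q₃(a | z)`. -/
def f (S : Problem Rh R Z X) (p : Z → X → Rh → ℝ) (q : Aux Rh Z X) : ℝ :=
  (∑ a, ∑ z, ∑ x, p z x a * S.pZX z x *
    Real.logb 2 ((2 : ℝ) ^ S.dbar a z x * p z x a ^ (S.μ₁ + S.μ₂) /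
      (q.q₂ a x z ^ S.μ₁ * q.q₁ a ^ S.μ₁ * q.q₃ z a ^ S.μ₂))) + S.θ

/-- The unnormalised right-hand side of the update of `p`. -/
def weight (S : Problem Rh R Z X) (q : Aux Rh Z X) (z : Z) (x : X) (a : Rh) : ℝ :=
  (q.q₁ a ^ S.μ₁ * q.q₂ a x z ^ S.μ₁ * q.q₃ z a ^ S.μ₂ * (2 : ℝ) ^ (-S.dbar a z x)) ^
    (1 / (S.μ₁ + S.μ₂))

/-- The normalisation factor `η(x, z)`. -/
def eta (S : Problem Rh R Z X) (q : Aux Rh Z X) (z : Z) (x : X) : ℝ :=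
  ∑ a, S.weight q z x a

/-- The update of `p`. -/
def pStep (S : Problem Rh R Z X) (q : Aux Rh Z X) : Z → X → Rh → ℝ :=
  fun z x a => 1 / S.eta q z x * S.weight q z x a

/-- The update of `q₁`. -/
def q₁Step (S : Problem Rh R Z X) (p : Z → X → Rh → ℝ) : Rh → ℝ :=
  fun a => ∑ z, ∑ x, p z x a * S.pZX z x

/-- The update of `q₂`. -/
def q₂Step (S : Problem Rh R Z X) (p : Z → X → Rh → ℝ) : Rh → X → Z → ℝ :=
  fun a x z => p z x a * (S.pZX z x / S.pX x) / ∑ z', p z' x a * (S.pZX z' x / S.pX x)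

/-- The update of `q₃`. -/
def q₃Step (S : Problem Rh R Z X) (p : Z → X → Rh → ℝ) : Z → Rh → ℝ :=
  fun z a => ∑ x, p z x a * (S.pZX z x / S.pZ z)

/-- The three updates of the auxiliary variables. -/
def qStep (S : Problem Rh R Z X) (p : Z → X → Rh → ℝ) : Aux Rh Z X :=
  ⟨S.q₁Step p, S.q₂Step p, S.q₃Step p⟩

/-- The auxiliary variables `qᵗ` of the modified Blahut–Arimoto iteration started at `q⁰`. -/
def qIter (S : Problem Rh R Z X) (q0 : Aux Rh Z X) : ℕ → Aux Rh Z X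
  | 0 => q0
  | t + 1 => S.qStep (S.pStep (qIter S q0 t))

/-- The kernels `pᵗ` of the modified Blahut–Arimoto iteration started at `q⁰`: iteration `t`
computes `pᵗ` from `qᵗ` and then `qᵗ⁺¹` from `pᵗ`. -/
def pIter (S : Problem Rh R Z X) (q0 : Aux Rh Z X) (t : ℕ) : Z → X → Rh → ℝ :=
  S.pStep (S.qIter q0 t)

end Problem

end DataRelease

end

/-!
The iteration is an alternating minimisation of `f`, and its convergence follows the pattern of
Csiszár and Tusnády, with the conditional relative entropy `D(p ‖ p' | Z, X)` (`condKL`) as distance.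

For fixed `p`, the objective `f` splits into three cross-entropy terms, one for each of
the auxiliary variables (`IsChannelOn.f_sub_f`), and Gibbs' inequality shows that each update
minimises its term. At the minimum `f` equals the Lagrangian `g` (`IsChannelOn.g_eq_f`), so the lower bounds reduce to
the non-negativity of distortion and of mutual information. For fixed `q`, taking logarithms in the
update of `p` gives `f(p; q) = f(pStep q; q) + c D(p ‖ pStep q | Z, X)` with
`c = (μ₁ + μ₂) / log 2` (`AuxPosOn.f_eq_f_pStep_add`). Hence the update of `p` minimises `f` as well,
and it fails to decrease `f` strictly only when `p` is already a fixed point.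

For convergence, let `p` be any channel. Replacing its auxiliary variables by those of `p'` raises
`f(p; ·)` by at most `c D(p ‖ p' | Z, X)` (`IsChannelOn.f_qStep_sub_g_le`): the terms in `q₁` and
`q₂` together are bounded by the chain rule and the log-sum inequality, the term in `q₃` by the
log-sum inequality, and the weights `μ₁` and `μ₂` add up. Together with the previous identity,
`f(pᵗ⁺¹; qᵗ⁺¹) - g(p) ≤ c (D(p ‖ pᵗ | Z, X) - D(p ‖ pᵗ⁺¹ | Z, X))`. If `p` minimises `g`, the left
side is non-negative; so the divergence decreases along the iteration, its decrements tend to zero,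
and both `f` and `g` tend to the minimum. By compactness a subsequence of the `pᵗ` converges to a
minimiser; the divergence from that minimiser is monotone and vanishes along the subsequence, hence
altogether, and it controls the Hellinger distance. If some minimiser is positive, the bounded
divergence from it keeps the limit positive, and a positive minimiser is a fixed point because one
more iteration cannot lower `g`.
-/

namespace DataRelease

open Filter Topology

/-! ### Inequalities between finite non-negative vectors -/

/-- The tangent-line bound behind Gibbs' inequality, sharpened by the squared Hellinger distance. -/
lemma sub_add_sq_sqrt_le_mul_log_div {u v : ℝ} (hu : 0 ≤ u) (hv : 0 ≤ v) (h : 0 < u → 0 < v) :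
    u - v + (√u - √v) ^ 2 ≤ u * Real.log (u / v) := by
  rcases hu.eq_or_lt with rfl | hu'
  · simp [Real.sq_sqrt hv]
  · have hv' := h hu'
    have su := Real.sqrt_pos.2 hu'
    have sv := Real.sqrt_pos.2 hv'
    -- the logarithm of `u / v` is twice that of `√u / √v`
    have h1 : Real.log (u / v) = -(2 * Real.log (√v / √u)) := by
      rw [Real.log_div hu'.ne' hv'.ne', Real.log_div sv.ne' su.ne', Real.log_sqrt hv,
        Real.log_sqrt hu]
      ring
    have h2 := Real.log_le_sub_one_of_pos (div_pos sv su)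
    have h3 : u * (√v / √u) = √u * √v := by
      rw [mul_div_assoc', div_eq_iff su.ne']
      nlinarith [Real.mul_self_sqrt hu]
    have h4 := mul_le_mul_of_nonneg_left h2 hu
    rw [mul_sub, h3] at h4
    rw [h1]
    nlinarith [Real.sq_sqrt hu, Real.sq_sqrt hv]

/-- Gibbs' inequality for vectors that need not be normalised. -/
lemma sum_sub_sum_le_sum_mul_log_div {ι : Type*} [Fintype ι] {u v : ι → ℝ} (hu : ∀ i, 0 ≤ u i)
    (hv : ∀ i, 0 ≤ v i) (h : ∀ i, 0 < u i → 0 < v i) :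
    ∑ i, u i - ∑ i, v i ≤ ∑ i, u i * Real.log (u i / v i) := by
  rw [← Finset.sum_sub_distrib]
  exact Finset.sum_le_sum fun i _ => by
    nlinarith [sub_add_sq_sqrt_le_mul_log_div (hu i) (hv i) (h i), sq_nonneg (√(u i) - √(v i))]

/-- The log-sum inequality. -/
lemma sum_mul_log_sum_div_sum_le {ι : Type*} [Fintype ι] {u v : ι → ℝ} (hu : ∀ i, 0 ≤ u i)
    (hv : ∀ i, 0 ≤ v i) (h : ∀ i, 0 < u i → 0 < v i) :
    (∑ i, u i) * Real.log ((∑ i, u i) / ∑ i, v i) ≤ ∑ i, u i * Real.log (u i / v i) := by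
  rcases (Finset.sum_nonneg fun i _ => hu i : 0 ≤ ∑ i, u i).eq_or_lt with h0 | hU
  · have hz : ∀ i, u i = 0 := fun i =>
      (Finset.sum_eq_zero_iff_of_nonneg fun i _ => hu i).1 h0.symm i (Finset.mem_univ i)
    simp [hz]
  · have hV : 0 < ∑ i, v i := by
      obtain ⟨i, -, hi⟩ := Finset.exists_lt_of_sum_lt (s := Finset.univ) (f := fun _ => (0 : ℝ))
        (g := u) (by simpa using hU)
      exact Finset.sum_pos' (fun i _ => hv i) ⟨i, Finset.mem_univ i, h i hi⟩
    set U := ∑ i, u i with hUd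
    set V := ∑ i, v i with hVd
    -- compare `u` with `v` rescaled to the total mass of `u`
    have key := sum_sub_sum_le_sum_mul_log_div (u := u) (v := fun i => U / V * v i) hu
      (fun i => mul_nonneg (div_pos hU hV).le (hv i)) (fun i hi => mul_pos (div_pos hU hV) (h i hi))
    rw [← Finset.mul_sum, ← hUd, ← hVd, div_mul_cancel₀ _ hV.ne', sub_self] at key
    have e : ∑ i, u i * Real.log (u i / (U / V * v i))
        = ∑ i, u i * Real.log (u i / v i) - U * Real.log (U / V) := by
      rw [hUd, Finset.sum_mul, ← Finset.sum_sub_distrib, ← hUd]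
      refine Finset.sum_congr rfl fun i _ => ?_
      rcases (hu i).eq_or_lt with h1 | h1
      · simp [← h1]
      · rw [Real.log_div h1.ne' (mul_pos (div_pos hU hV) (h i h1)).ne',
          Real.log_mul (div_pos hU hV).ne' (h i h1).ne', Real.log_div h1.ne' (h i h1).ne']
        ring
    linarith

/-! ### Mutual information -/

lemma mutualInfo_nonneg {A B : Type*} [Fintype A] [Fintype B] {J : A → B → ℝ}
    (hJ : ∀ a b, 0 ≤ J a b) (h1 : ∑ a, ∑ b, J a b = 1) : 0 ≤ mutualInfo J := by
  have hA : ∀ a b, 0 < J a b → 0 < ∑ b', J a b' := fun a b h =>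
    Finset.sum_pos' (fun b _ => hJ a b) ⟨b, Finset.mem_univ b, h⟩
  have hB : ∀ a b, 0 < J a b → 0 < ∑ a', J a' b := fun a b h =>
    Finset.sum_pos' (fun a _ => hJ a b) ⟨a, Finset.mem_univ a, h⟩
  have key := sum_sub_sum_le_sum_mul_log_div (u := fun i : A × B => J i.1 i.2)
    (v := fun i => (∑ b', J i.1 b') * ∑ a', J a' i.2) (fun i => hJ _ _)
    (fun i => mul_nonneg (Finset.sum_nonneg fun b _ => hJ _ b) (Finset.sum_nonneg fun a _ => hJ a _))
    (fun i hi => mul_pos (hA _ _ hi) (hB _ _ hi))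
  simp only [Fintype.sum_prod_type, ← Finset.mul_sum, ← Finset.sum_mul] at key
  rw [h1, Finset.sum_comm (f := fun b a => J a b), h1] at key
  have e : mutualInfo J = (∑ a, ∑ b, J a b * Real.log (J a b / ((∑ b', J a b') * ∑ a', J a' b)))
      / Real.log 2 := by
    simp only [mutualInfo, Real.logb, Finset.sum_div, mul_div_assoc]
  rw [e]
  exact div_nonneg (by linarith) (Real.log_nonneg (by norm_num))

/-- Mutual information as a combination of entropies, an expression continuous in `J`. -/
lemma mutualInfo_eq_negMulLog {A B : Type*} [Fintype A] [Fintype B] {J : A → B → ℝ}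
    (hJ : ∀ a b, 0 ≤ J a b) :
    mutualInfo J = (∑ a, Real.negMulLog (∑ b, J a b) + ∑ b, Real.negMulLog (∑ a, J a b)
      - ∑ a, ∑ b, Real.negMulLog (J a b)) / Real.log 2 := by
  have hA : ∀ a b, 0 < J a b → 0 < ∑ b', J a b' := fun a b h =>
    Finset.sum_pos' (fun b _ => hJ a b) ⟨b, Finset.mem_univ b, h⟩
  have hB : ∀ a b, 0 < J a b → 0 < ∑ a', J a' b := fun a b h =>
    Finset.sum_pos' (fun a _ => hJ a b) ⟨a, Finset.mem_univ a, h⟩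
  have e1 : ∑ a, Real.negMulLog (∑ b, J a b) = ∑ a, ∑ b, -(J a b * Real.log (∑ b', J a b')) := by
    simp [Real.negMulLog, Finset.sum_mul]
  have e2 : ∑ b, Real.negMulLog (∑ a, J a b) = ∑ a, ∑ b, -(J a b * Real.log (∑ a', J a' b)) := by
    rw [Finset.sum_comm]
    simp [Real.negMulLog, Finset.sum_mul]
  rw [e1, e2]
  simp only [mutualInfo, ← Finset.sum_add_distrib, ← Finset.sum_sub_distrib, Finset.sum_div]
  refine Finset.sum_congr rfl fun a _ => Finset.sum_congr rfl fun b _ => ?_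
  rcases (hJ a b).eq_or_lt with h | h
  · simp [← h]
  · rw [Real.logb, Real.log_div h.ne' (mul_pos (hA a b h) (hB a b h)).ne',
      Real.log_mul (hA a b h).ne' (hB a b h).ne', Real.negMulLog]
    ring

/-! ### The set of channels -/

lemma isCompact_setOf_isChannel {Rh Z X : Type*} [Fintype Rh] :
    IsCompact {p : Z → X → Rh → ℝ | IsChannel p} := by
  have : {p : Z → X → Rh → ℝ | IsChannel p} =
      Set.univ.pi fun _ => Set.univ.pi fun _ => stdSimplex ℝ Rh := by
    ext p
    simp [IsChannel, Set.mem_pi]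
  rw [this]
  exact isCompact_univ_pi fun _ => isCompact_univ_pi fun _ => isCompact_stdSimplex ℝ Rh

lemma exists_isChannel {Rh Z X : Type*} [Fintype Rh] [Nonempty Rh] :
    ∃ p : Z → X → Rh → ℝ, IsChannel p := by
  classical
  exact ⟨fun _ _ => Pi.single (Classical.arbitrary Rh) 1, fun _ _ => single_mem_stdSimplex _ _⟩

namespace Problem

variable {Rh R Z X : Type*} [Fintype R] [Fintype Z] [Fintype X]
  {S : Problem Rh R Z X} {p p' : Z → X → Rh → ℝ} {q q' q0 : Aux Rh Z X}

/-! ### The joint distribution of `(Z, X)` and cancellations in the updates -/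

lemma pZX_nonneg (S : Problem Rh R Z X) (z : Z) (x : X) : 0 ≤ S.pZX z x :=
  Finset.sum_nonneg fun r _ => S.P_nonneg r z x

lemma pZX_sum (S : Problem Rh R Z X) : ∑ z, ∑ x, S.pZX z x = 1 := by
  rw [← S.P_sum, Finset.sum_comm (f := fun r z => ∑ x, S.P r z x)]
  simp only [pZX]
  exact Finset.sum_congr rfl fun z _ => Finset.sum_comm

lemma exists_pZX_pos (S : Problem Rh R Z X) : ∃ z x, 0 < S.pZX z x := by
  by_contra! h
  have : ∑ z, ∑ x, S.pZX z x ≤ 0 :=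
    Finset.sum_nonpos fun z _ => Finset.sum_nonpos fun x _ => h z x
  linarith [S.pZX_sum]

lemma pZ_pos {z : Z} {x : X} (h : 0 < S.pZX z x) : 0 < S.pZ z :=
  Finset.sum_pos' (fun x _ => S.pZX_nonneg z x) ⟨x, Finset.mem_univ x, h⟩

lemma pX_pos {z : Z} {x : X} (h : 0 < S.pZX z x) : 0 < S.pX x :=
  Finset.sum_pos' (fun z _ => S.pZX_nonneg z x) ⟨z, Finset.mem_univ z, h⟩

lemma P_eq_zero {z : Z} {x : X} (h : S.pZX z x = 0) (r : R) : S.P r z x = 0 :=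
  (Finset.sum_eq_zero_iff_of_nonneg fun r _ => S.P_nonneg r z x).1 h r (Finset.mem_univ r)

lemma pos_of_mass_pos {z : Z} {x : X} {a : Rh}
    (h : 0 < p z x a * S.pZX z x) : 0 < S.pZX z x ∧ 0 < p z x a :=
  have h1 := lt_of_le_of_ne (S.pZX_nonneg z x) fun h0 => by simp [← h0] at h
  ⟨h1, pos_of_mul_pos_left h h1.le⟩

/-- The constant by which the divergence, in nats, enters the objective, in bits. -/
lemma factor_pos (S : Problem Rh R Z X) : 0 < (S.μ₁ + S.μ₂) / Real.log 2 :=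
  div_pos S.μ_pos (Real.log_pos (by norm_num))

/-- The factors `p(x)` in the update of `q₂` cancel, also where `p(x) = 0`. -/
lemma q₂Step_eq (S : Problem Rh R Z X) (p : Z → X → Rh → ℝ) (a : Rh) (x : X) (z : Z) :
    S.q₂Step p a x z = p z x a * S.pZX z x / ∑ z', p z' x a * S.pZX z' x := by
  simp only [q₂Step, mul_div_assoc', ← Finset.sum_div]
  have h0 : 0 ≤ S.pX x := Finset.sum_nonneg fun z _ => S.pZX_nonneg z x
  rcases h0.eq_or_lt with h | h
  · have : S.pZX z x = 0 :=
      (Finset.sum_eq_zero_iff_of_nonneg fun z _ => S.pZX_nonneg z x).1 h.symm z (Finset.mem_univ z)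
    simp [this]
  · exact div_div_div_cancel_right₀ h.ne' _ _

lemma q₃Step_eq (S : Problem Rh R Z X) (p : Z → X → Rh → ℝ) (z : Z) (a : Rh) :
    S.q₃Step p z a = (∑ x, p z x a * S.pZX z x) / S.pZ z := by
  simp only [q₃Step, mul_div_assoc', ← Finset.sum_div]

lemma qStep_congr (h : ∀ z x, 0 < S.pZX z x → p z x = p' z x) : S.qStep p = S.qStep p' := by
  have h1 : ∀ z x a, p z x a * S.pZX z x = p' z x a * S.pZX z x := fun z x a => by
    rcases (S.pZX_nonneg z x).eq_or_lt with h0 | h0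
    · simp [← h0]
    · rw [h z x h0]
  have e1 : S.q₁Step p = S.q₁Step p' := by
    funext a
    simp only [q₁Step, h1]
  have e2 : S.q₂Step p = S.q₂Step p' := by
    funext a x z
    simp only [q₂Step_eq, h1]
  have e3 : S.q₃Step p = S.q₃Step p' := by
    funext z a
    simp only [q₃Step_eq, h1]
  rw [qStep, qStep, e1, e2, e3]

/-! ### Channels and auxiliary variables on the support of `(Z, X)` -/

/-- The auxiliary variables are positive where the pair `(Z, X)` has positive probability. -/
def AuxPosOn (S : Problem Rh R Z X) (q : Aux Rh Z X) : Prop :=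
  ∀ z x, 0 < S.pZX z x → ∀ a, 0 < q.q₁ a ∧ 0 < q.q₂ a x z ∧ 0 < q.q₃ z a

/-- The auxiliary variables are positive wherever `p(a | z, x) p(z, x)` is, so that `f(p; q)` is
free of junk values. -/
def Compatible (S : Problem Rh R Z X) (p : Z → X → Rh → ℝ) (q : Aux Rh Z X) : Prop :=
  ∀ z x a, 0 < S.pZX z x → 0 < p z x a → 0 < q.q₁ a ∧ 0 < q.q₂ a x z ∧ 0 < q.q₃ z a

lemma AuxPosOn.compatible (h : S.AuxPosOn q) : S.Compatible p q := fun z x a h0 _ => h z x h0 a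

lemma AuxPosOn.weight_pos (hq : S.AuxPosOn q) {z : Z} {x : X} (h : 0 < S.pZX z x) (a : Rh) :
    0 < S.weight q z x a := by
  obtain ⟨h1, h2, h3⟩ := hq z x h a
  unfold weight
  positivity

variable [Fintype Rh]

/-- `p` is a channel at the pairs `(z, x)` of positive probability; the other pairs are
unconstrained, because the iterates need not be normalised there. -/
def IsChannelOn (S : Problem Rh R Z X) (p : Z → X → Rh → ℝ) : Prop :=
  ∀ z x, 0 < S.pZX z x → p z x ∈ stdSimplex ℝ Rh

/-- All entries of `p` are positive at the pairs `(z, x)` of positive probability. -/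
def IsPosOn (S : Problem Rh R Z X) (p : Z → X → Rh → ℝ) : Prop :=
  ∀ z x, 0 < S.pZX z x → ∀ a, 0 < p z x a

/-- The auxiliary variables are (conditional) distributions where the pair `(Z, X)` has positive
probability. -/
def IsDistOn (S : Problem Rh R Z X) (q : Aux Rh Z X) : Prop :=
  ∀ z x, 0 < S.pZX z x →
    q.q₁ ∈ stdSimplex ℝ Rh ∧ (∀ a, q.q₂ a x ∈ stdSimplex ℝ Z) ∧ q.q₃ z ∈ stdSimplex ℝ Rh

lemma _root_.DataRelease.IsChannel.on (h : IsChannel p) : S.IsChannelOn p := fun z x _ => h z x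

/-- `p z x a * S.pZX z x` is the joint mass function of `(R̂, Z, X)`; it is non-negative everywhere,
also where `p` is unconstrained. -/
lemma IsChannelOn.mass_nonneg (hp : S.IsChannelOn p) (z : Z) (x : X) (a : Rh) :
    0 ≤ p z x a * S.pZX z x := by
  rcases (S.pZX_nonneg z x).eq_or_lt with h | h
  · simp [← h]
  · exact mul_nonneg ((hp z x h).1 a) h.le

lemma IsChannelOn.sum_mass (hp : S.IsChannelOn p) (z : Z) (x : X) :
    ∑ a, p z x a * S.pZX z x = S.pZX z x := by
  rw [← Finset.sum_mul]
  rcases (S.pZX_nonneg z x).eq_or_lt with h | h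
  · simp [← h]
  · rw [(hp z x h).2, one_mul]

lemma IsChannelOn.q₁Step_pos (hp : S.IsChannelOn p) {z : Z} {x : X} {a : Rh}
    (h : 0 < p z x a * S.pZX z x) : 0 < S.q₁Step p a :=
  Finset.sum_pos' (fun z _ => Finset.sum_nonneg fun x _ => hp.mass_nonneg z x a)
    ⟨z, Finset.mem_univ z, Finset.sum_pos' (fun x _ => hp.mass_nonneg z x a)
      ⟨x, Finset.mem_univ x, h⟩⟩

lemma IsChannelOn.sum_mass_Z_pos (hp : S.IsChannelOn p) {z : Z} {x : X} {a : Rh}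
    (h : 0 < p z x a * S.pZX z x) : 0 < ∑ z', p z' x a * S.pZX z' x :=
  Finset.sum_pos' (fun z _ => hp.mass_nonneg z x a) ⟨z, Finset.mem_univ z, h⟩

lemma IsChannelOn.sum_mass_X_pos (hp : S.IsChannelOn p) {z : Z} {x : X} {a : Rh}
    (h : 0 < p z x a * S.pZX z x) : 0 < ∑ x', p z x' a * S.pZX z x' :=
  Finset.sum_pos' (fun x _ => hp.mass_nonneg z x a) ⟨x, Finset.mem_univ x, h⟩

/-! ### The updates of the auxiliary variables -/

lemma IsChannelOn.compatible_qStep (hp : S.IsChannelOn p) : S.Compatible p (S.qStep p) := by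
  intro z x a h0 h
  have hm := mul_pos h h0
  refine ⟨hp.q₁Step_pos hm, ?_, ?_⟩
  · simp only [qStep, q₂Step_eq]
    exact div_pos hm (hp.sum_mass_Z_pos hm)
  · simp only [qStep, q₃Step_eq]
    exact div_pos (hp.sum_mass_X_pos hm) (pZ_pos h0)

lemma IsPosOn.auxPosOn_qStep (hpos : S.IsPosOn p) (hp : S.IsChannelOn p) :
    S.AuxPosOn (S.qStep p) :=
  fun z x h a => hp.compatible_qStep z x a h (hpos z x h a)

lemma IsChannelOn.q₁Step_nonneg (hp : S.IsChannelOn p) (a : Rh) : 0 ≤ S.q₁Step p a :=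
  Finset.sum_nonneg fun z _ => Finset.sum_nonneg fun x _ => hp.mass_nonneg z x a

lemma IsChannelOn.sum_q₁Step (hp : S.IsChannelOn p) : ∑ a, S.q₁Step p a = 1 := by
  simp only [q₁Step]
  rw [Finset.sum_comm, ← S.pZX_sum]
  refine Finset.sum_congr rfl fun z _ => ?_
  rw [Finset.sum_comm]
  exact Finset.sum_congr rfl fun x _ => hp.sum_mass z x

lemma IsChannelOn.sum_sum_mass_X (hp : S.IsChannelOn p) (z : Z) :
    ∑ a, ∑ x, p z x a * S.pZX z x = S.pZ z := by
  rw [Finset.sum_comm]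
  exact Finset.sum_congr rfl fun x _ => hp.sum_mass z x

lemma IsPosOn.isDistOn_qStep (hpos : S.IsPosOn p) (hp : S.IsChannelOn p) :
    S.IsDistOn (S.qStep p) := by
  intro z x h
  refine ⟨⟨hp.q₁Step_nonneg, hp.sum_q₁Step⟩, fun a => ⟨fun z' => ?_, ?_⟩, fun a => ?_, ?_⟩
  · simp only [qStep, q₂Step_eq]
    exact div_nonneg (hp.mass_nonneg _ _ _) (Finset.sum_nonneg fun z _ => hp.mass_nonneg _ _ _)
  · simp only [qStep, q₂Step_eq, ← Finset.sum_div]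
    exact div_self (hp.sum_mass_Z_pos (mul_pos (hpos z x h a) h)).ne'
  · simp only [qStep, q₃Step_eq]
    exact div_nonneg (Finset.sum_nonneg fun z _ => hp.mass_nonneg _ _ _) (pZ_pos h).le
  · simp only [qStep, q₃Step_eq, ← Finset.sum_div]
    rw [hp.sum_sum_mass_X, div_self (pZ_pos h).ne']

/-! ### The objective `f` and its three auxiliary terms -/

/-- The objective `f` with its logarithm split into a sum, terms of zero weight included. -/
lemma IsChannelOn.f_eq_sum_log (hp : S.IsChannelOn p) (h : S.Compatible p q) :
    S.f p q = ∑ a, ∑ z, ∑ x, p z x a * S.pZX z x * (S.dbar a z x +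
      ((S.μ₁ + S.μ₂) * Real.log (p z x a) - S.μ₁ * Real.log (q.q₂ a x z)
        - S.μ₁ * Real.log (q.q₁ a) - S.μ₂ * Real.log (q.q₃ z a)) / Real.log 2) + S.θ := by
  unfold f
  congr 1
  refine Finset.sum_congr rfl fun a _ => Finset.sum_congr rfl fun z _ =>
    Finset.sum_congr rfl fun x _ => ?_
  rcases (hp.mass_nonneg z x a).eq_or_lt with h0 | h0
  · simp [← h0]
  · obtain ⟨h1, h2⟩ := pos_of_mass_pos h0
    obtain ⟨h3, h4, h5⟩ := h z x a h1 h2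
    have l2 : Real.log 2 ≠ 0 := (Real.log_pos (by norm_num)).ne'
    congr 1
    rw [Real.logb, Real.log_div (by positivity) (by positivity),
      Real.log_mul (by positivity) (by positivity), Real.log_mul (by positivity) (by positivity),
      Real.log_mul (by positivity) (by positivity), Real.log_rpow (by norm_num),
      Real.log_rpow h2, Real.log_rpow h3, Real.log_rpow h4, Real.log_rpow h5]
    field_simp
    ring

/-- For fixed `p`, the objective `f` separates into one term for each auxiliary variable. -/
lemma IsChannelOn.f_sub_f (hp : S.IsChannelOn p) (h : S.Compatible p q)
    (h' : S.Compatible p q') :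
    S.f p q - S.f p q' = (S.μ₁ * ∑ a, S.q₁Step p a * (Real.log (q'.q₁ a) - Real.log (q.q₁ a))
      + S.μ₁ * ∑ a, ∑ x, ∑ z, p z x a * S.pZX z x *
          (Real.log (q'.q₂ a x z) - Real.log (q.q₂ a x z))
      + S.μ₂ * ∑ z, ∑ a, (∑ x, p z x a * S.pZX z x) *
          (Real.log (q'.q₃ z a) - Real.log (q.q₃ z a))) / Real.log 2 := by
  rw [hp.f_eq_sum_log h, hp.f_eq_sum_log h', add_sub_add_right_eq_sub,
    Finset.sum_comm (f := fun z a => (∑ x, p z x a * S.pZX z x) *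
          (Real.log (q'.q₃ z a) - Real.log (q.q₃ z a)))]
  simp only [Finset.sum_comm (f := fun x z => p z x _ * S.pZX z x *
          (Real.log (q'.q₂ _ x z) - Real.log (q.q₂ _ x z)))]
  simp only [q₁Step, Finset.sum_mul, Finset.mul_sum, ← Finset.sum_add_distrib,
    ← Finset.sum_sub_distrib, Finset.sum_div]
  refine Finset.sum_congr rfl fun a _ => Finset.sum_congr rfl fun z _ =>
    Finset.sum_congr rfl fun x _ => ?_
  ring

/-- The update of `q₁` minimises its term of `f`, by Gibbs' inequality between `q₁Step p` and `q₁`. -/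
lemma IsChannelOn.q₁_gibbs (hp : S.IsChannelOn p) (hq : S.IsDistOn q) (h : S.Compatible p q) :
    0 ≤ ∑ a, S.q₁Step p a * (Real.log (S.q₁Step p a) - Real.log (q.q₁ a)) := by
  obtain ⟨z₀, x₀, h0⟩ := S.exists_pZX_pos
  have hq1 := (hq z₀ x₀ h0).1
  have hpos : ∀ a, 0 < S.q₁Step p a → 0 < q.q₁ a := fun a ha => by
    obtain ⟨z, -, hz⟩ := Finset.exists_lt_of_sum_lt (s := Finset.univ) (f := fun _ => (0 : ℝ))
      (g := fun z => ∑ x, p z x a * S.pZX z x) (by simpa [q₁Step] using ha)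
    obtain ⟨x, -, hx⟩ := Finset.exists_lt_of_sum_lt (s := Finset.univ) (f := fun _ => (0 : ℝ))
      (g := fun x => p z x a * S.pZX z x) (by simpa using hz)
    obtain ⟨h1, h2⟩ := pos_of_mass_pos hx
    exact (h z x a h1 h2).1
  have key := sum_sub_sum_le_sum_mul_log_div hp.q₁Step_nonneg hq1.1 hpos
  rw [hp.sum_q₁Step, hq1.2, sub_self] at key
  refine key.trans_eq (Finset.sum_congr rfl fun a _ => ?_)
  rcases (hp.q₁Step_nonneg a).eq_or_lt with h1 | h1
  · simp [← h1]
  · rw [Real.log_div h1.ne' (hpos a h1).ne']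

/-- The update of `q₂` minimises its term of `f`. For each `(a, x)` Gibbs' inequality compares the
unnormalised masses, so that a pair `(a, x)` of mass `0`, where `q₂Step p` is not a distribution,
needs no separate argument. -/
lemma IsChannelOn.q₂_gibbs (hp : S.IsChannelOn p) (hq : S.IsDistOn q) (h : S.Compatible p q) :
    0 ≤ ∑ a, ∑ x, ∑ z, p z x a * S.pZX z x *
      (Real.log (S.q₂Step p a x z) - Real.log (q.q₂ a x z)) := by
  refine Finset.sum_nonneg fun a _ => Finset.sum_nonneg fun x _ => ?_
  by_cases hx : ∃ z, 0 < S.pZX z x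
  · obtain ⟨z₀, h0⟩ := hx
    have hq2 := (hq z₀ x h0).2.1 a
    have hpos : ∀ z, 0 < p z x a * S.pZX z x →
        0 < (∑ z', p z' x a * S.pZX z' x) * q.q₂ a x z := fun z hz =>
      have hh := pos_of_mass_pos hz
      mul_pos (hp.sum_mass_Z_pos hz) (h z x a hh.1 hh.2).2.1
    have key := sum_sub_sum_le_sum_mul_log_div (u := fun z => p z x a * S.pZX z x)
      (fun z => hp.mass_nonneg z x a)
      (fun z => mul_nonneg (Finset.sum_nonneg fun z _ => hp.mass_nonneg z x a) (hq2.1 z)) hpos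
    rw [← Finset.mul_sum, hq2.2, mul_one, sub_self] at key
    refine key.trans_eq (Finset.sum_congr rfl fun z _ => ?_)
    rcases (hp.mass_nonneg z x a).eq_or_lt with h1 | h1
    · simp [← h1]
    · have h2 := hpos z h1
      have h3 := hp.sum_mass_Z_pos h1
      have h4 : 0 < q.q₂ a x z := pos_of_mul_pos_right h2 h3.le
      rw [q₂Step_eq, Real.log_div h1.ne' h2.ne', Real.log_div h1.ne' h3.ne',
        Real.log_mul h3.ne' h4.ne']
      ring
  · push Not at hx
    have : ∀ z, S.pZX z x = 0 := fun z => le_antisymm (hx z) (S.pZX_nonneg z x)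
    simp [this]

/-- The update of `q₃` minimises its term of `f`, by Gibbs' inequality for each `z`. -/
lemma IsChannelOn.q₃_gibbs (hp : S.IsChannelOn p) (hq : S.IsDistOn q) (h : S.Compatible p q) :
    0 ≤ ∑ z, ∑ a, (∑ x, p z x a * S.pZX z x) *
      (Real.log (S.q₃Step p z a) - Real.log (q.q₃ z a)) := by
  refine Finset.sum_nonneg fun z _ => ?_
  by_cases hx : ∃ x, 0 < S.pZX z x
  · obtain ⟨x₀, h0⟩ := hx
    have hq3 := (hq z x₀ h0).2.2
    have hZ := pZ_pos h0
    have hn : ∀ a, 0 ≤ ∑ x, p z x a * S.pZX z x := fun a =>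
      Finset.sum_nonneg fun x _ => hp.mass_nonneg z x a
    have hpos : ∀ a, 0 < ∑ x, p z x a * S.pZX z x → 0 < q.q₃ z a := fun a ha => by
      obtain ⟨x, -, hx⟩ := Finset.exists_lt_of_sum_lt (s := Finset.univ) (f := fun _ => (0 : ℝ))
        (g := fun x => p z x a * S.pZX z x) (by simpa using ha)
      obtain ⟨h1, h2⟩ := pos_of_mass_pos hx
      exact (h z x a h1 h2).2.2
    have key := sum_sub_sum_le_sum_mul_log_div (u := fun a => ∑ x, p z x a * S.pZX z x)
      (v := fun a => S.pZ z * q.q₃ z a) hn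
      (fun a => mul_nonneg hZ.le (hq3.1 a)) fun a ha => mul_pos hZ (hpos a ha)
    rw [← Finset.mul_sum, hq3.2, mul_one, hp.sum_sum_mass_X, sub_self] at key
    refine key.trans_eq (Finset.sum_congr rfl fun a _ => ?_)
    rcases (hn a).eq_or_lt with h1 | h1
    · simp [← h1]
    · rw [q₃Step_eq, Real.log_div h1.ne' (mul_pos hZ (hpos a h1)).ne',
        Real.log_div h1.ne' hZ.ne', Real.log_mul hZ.ne' (hpos a h1).ne']
      ring
  · push Not at hx
    have : ∀ x, S.pZX z x = 0 := fun x => le_antisymm (hx x) (S.pZX_nonneg z x)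
    simp [this]

/-- Each of the three updates of the auxiliary variables decreases `f`. -/
lemma IsChannelOn.f_steps (hp : S.IsChannelOn p) (hq : S.IsDistOn q) (h : S.Compatible p q) :
    S.f p ⟨S.q₁Step p, q.q₂, q.q₃⟩ ≤ S.f p q ∧
      S.f p ⟨S.q₁Step p, S.q₂Step p, q.q₃⟩ ≤ S.f p ⟨S.q₁Step p, q.q₂, q.q₃⟩ ∧
      S.f p (S.qStep p) ≤ S.f p ⟨S.q₁Step p, S.q₂Step p, q.q₃⟩ := by
  have hs := hp.compatible_qStep
  have h1 : S.Compatible p ⟨S.q₁Step p, q.q₂, q.q₃⟩ := fun z x a h0 ha =>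
    ⟨(hs z x a h0 ha).1, (h z x a h0 ha).2⟩
  have h2 : S.Compatible p ⟨S.q₁Step p, S.q₂Step p, q.q₃⟩ := fun z x a h0 ha =>
    ⟨(hs z x a h0 ha).1, (hs z x a h0 ha).2.1, (h z x a h0 ha).2.2⟩
  have l2 : 0 ≤ Real.log 2 := Real.log_nonneg (by norm_num)
  refine ⟨?_, ?_, ?_⟩ <;> rw [← sub_nonneg]
  · rw [hp.f_sub_f h h1]
    simpa using div_nonneg (mul_nonneg S.μ₁_nonneg (hp.q₁_gibbs hq h)) l2
  · rw [hp.f_sub_f h1 h2]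
    simpa using div_nonneg (mul_nonneg S.μ₁_nonneg (hp.q₂_gibbs hq h)) l2
  · rw [hp.f_sub_f h2 hs]
    simpa [qStep] using div_nonneg (mul_nonneg S.μ₂_nonneg (hp.q₃_gibbs hq h)) l2

lemma IsChannelOn.f_qStep_le (hp : S.IsChannelOn p) (hq : S.IsDistOn q) (h : S.Compatible p q) :
    S.f p (S.qStep p) ≤ S.f p q :=
  have hh := hp.f_steps hq h
  hh.2.2.trans (hh.2.1.trans hh.1)

/-! ### The objective `g` -/

/-- At the updated auxiliary variables, `f` is the Lagrangian. -/
lemma IsChannelOn.g_eq_f (hp : S.IsChannelOn p) : S.g p = S.f p (S.qStep p) := by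
  have eX : ∀ x, ∑ a, ∑ z, p z x a * S.pZX z x = S.pX x := fun x => by
    rw [Finset.sum_comm]
    exact Finset.sum_congr rfl fun z _ => hp.sum_mass z x
  have hD : S.expDistortion p = ∑ a, ∑ z, ∑ x, p z x a * S.pZX z x * S.dbar a z x := by
    unfold expDistortion
    refine Finset.sum_congr rfl fun a _ => ?_
    rw [Finset.sum_comm]
    refine Finset.sum_congr rfl fun z _ => ?_
    rw [Finset.sum_comm]
    refine Finset.sum_congr rfl fun x _ => ?_
    rw [dbar, Finset.mul_sum]
    refine Finset.sum_congr rfl fun r _ => ?_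
    by_cases h0 : S.pZX z x = 0
    · simp [h0, P_eq_zero h0 r]
    · field_simp
  have h1 : S.leakSingle p = ∑ a, ∑ z, ∑ x, p z x a * S.pZX z x *
      Real.logb 2 ((∑ z', p z' x a * S.pZX z' x) / (S.q₁Step p a * S.pX x)) := by
    unfold leakSingle mutualInfo
    refine Finset.sum_congr rfl fun a _ => ?_
    rw [Finset.sum_comm (f := fun z x => p z x a * S.pZX z x * _)]
    refine Finset.sum_congr rfl fun x _ => ?_
    rw [eX, ← Finset.sum_mul, Finset.sum_comm]
    rfl
  have h2 : S.leakJoint p = ∑ a, ∑ z, ∑ x, p z x a * S.pZX z x *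
      Real.logb 2 (p z x a * S.pZX z x / ((∑ x', p z x' a * S.pZX z x') * S.pX x)) := by
    unfold leakJoint mutualInfo
    simp only [Fintype.sum_prod_type, eX]
  have hθ : S.θ = (∑ a, ∑ z, ∑ x, p z x a * S.pZX z x *
      ((S.μ₁ + S.μ₂) * Real.logb 2 (S.pZX z x / (S.pZ z * S.pX x))
        + S.μ₁ * Real.logb 2 (S.pZ z))) - S.μ₁ * S.ε - S.μ₂ * S.δ := by
    unfold θ
    congr 2
    symm
    rw [Finset.sum_comm]
    refine Finset.sum_congr rfl fun z _ => ?_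
    rw [Finset.sum_comm]
    refine Finset.sum_congr rfl fun x _ => ?_
    rw [← Finset.sum_mul, hp.sum_mass]
  rw [hp.f_eq_sum_log hp.compatible_qStep, g, hD, h1, h2, hθ]
  -- all terms are now sums against the joint mass function and agree entry by entry
  suffices h : ∀ a z x, p z x a * S.pZX z x * S.dbar a z x + S.μ₁ * (p z x a * S.pZX z x *
      Real.logb 2 ((∑ z', p z' x a * S.pZX z' x) / (S.q₁Step p a * S.pX x)))
      + S.μ₂ * (p z x a * S.pZX z x *
      Real.logb 2 (p z x a * S.pZX z x / ((∑ x', p z x' a * S.pZX z x') * S.pX x))) =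
      p z x a * S.pZX z x * (S.dbar a z x +
      ((S.μ₁ + S.μ₂) * Real.log (p z x a) - S.μ₁ * Real.log ((S.qStep p).q₂ a x z)
        - S.μ₁ * Real.log ((S.qStep p).q₁ a) - S.μ₂ * Real.log ((S.qStep p).q₃ z a)) / Real.log 2)
      + p z x a * S.pZX z x *
      ((S.μ₁ + S.μ₂) * Real.logb 2 (S.pZX z x / (S.pZ z * S.pX x))
        + S.μ₁ * Real.logb 2 (S.pZ z)) by
    have hs := Finset.sum_congr (rfl : (Finset.univ : Finset Rh) = _) fun a _ =>
      Finset.sum_congr (rfl : (Finset.univ : Finset Z) = _) fun z _ =>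
      Finset.sum_congr (rfl : (Finset.univ : Finset X) = _) fun x _ => h a z x
    simp only [Finset.sum_add_distrib, ← Finset.mul_sum] at hs
    linarith
  intro a z x
  rcases (hp.mass_nonneg z x a).eq_or_lt with h0 | h0
  · simp [← h0]
  · obtain ⟨hP, ha⟩ := pos_of_mass_pos h0
    have hZ := pZ_pos hP
    have hX := pX_pos hP
    have hJ := hp.sum_mass_Z_pos h0
    have hW := hp.sum_mass_X_pos h0
    have hq := hp.q₁Step_pos h0
    have l2 : Real.log 2 ≠ 0 := (Real.log_pos (by norm_num)).ne'
    simp only [qStep, q₂Step_eq, q₃Step_eq, Real.logb]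
    rw [Real.log_div hJ.ne' (by positivity), Real.log_mul hq.ne' hX.ne',
      Real.log_div h0.ne' (by positivity), Real.log_mul hW.ne' hX.ne',
      Real.log_div h0.ne' hJ.ne', Real.log_div hW.ne' hZ.ne', Real.log_div hP.ne' (by positivity),
      Real.log_mul hZ.ne' hX.ne', Real.log_mul ha.ne' hP.ne']
    field_simp
    ring

lemma IsChannelOn.lower_bound_g (hp : S.IsChannelOn p) :
    -(S.μ₁ * S.ε + S.μ₂ * S.δ) ≤ S.g p := by
  have hD : 0 ≤ S.expDistortion p := by
    refine Finset.sum_nonneg fun a _ => Finset.sum_nonneg fun r _ => Finset.sum_nonneg fun z _ =>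
      Finset.sum_nonneg fun x _ => mul_nonneg ?_ (S.d_nonneg a r)
    rcases (S.pZX_nonneg z x).eq_or_lt with h | h
    · simp [P_eq_zero h.symm r]
    · exact mul_nonneg ((hp z x h).1 a) (S.P_nonneg r z x)
  have h1 : 0 ≤ S.leakSingle p :=
    mutualInfo_nonneg (fun a x => Finset.sum_nonneg fun z _ => hp.mass_nonneg z x a) <| by
      rw [← hp.sum_q₁Step]
      exact Finset.sum_congr rfl fun a _ => Finset.sum_comm
  have h2 : 0 ≤ S.leakJoint p :=
    mutualInfo_nonneg (fun b x => hp.mass_nonneg b.2 x b.1) <| by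
      rw [← hp.sum_q₁Step, Fintype.sum_prod_type]
      rfl
  unfold g
  nlinarith [mul_nonneg S.μ₁_nonneg h1, mul_nonneg S.μ₂_nonneg h2]

lemma IsChannelOn.lower_bound_f (hp : S.IsChannelOn p) (hq : S.IsDistOn q)
    (h : S.Compatible p q) : -(S.μ₁ * S.ε + S.μ₂ * S.δ) ≤ S.f p q :=
  (hp.lower_bound_g.trans_eq hp.g_eq_f).trans (hp.f_qStep_le hq h)

/-- The Lagrangian depends on the kernel only through the support of `(Z, X)`. -/
lemma g_congr (h : ∀ z x, 0 < S.pZX z x → p z x = p' z x) : S.g p = S.g p' := by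
  have h1 : ∀ z x a, p z x a * S.pZX z x = p' z x a * S.pZX z x := fun z x a => by
    rcases (S.pZX_nonneg z x).eq_or_lt with h0 | h0
    · simp [← h0]
    · rw [h z x h0]
  have h2 : ∀ r z x a, p z x a * S.P r z x = p' z x a * S.P r z x := fun r z x a => by
    rcases (S.pZX_nonneg z x).eq_or_lt with h0 | h0
    · simp [P_eq_zero h0.symm r]
    · rw [h z x h0]
  simp only [g, expDistortion, leakSingle, leakJoint, h1, h2]

lemma continuousOn_g (S : Problem Rh R Z X) : ContinuousOn S.g {p | IsChannel p} := by
  have hc := Real.continuous_negMulLog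
  have h1 : ContinuousOn S.leakSingle {p | IsChannel p} := by
    refine ContinuousOn.congr (Continuous.continuousOn ?_) fun p hp => mutualInfo_eq_negMulLog
      fun a x => Finset.sum_nonneg fun z _ => (hp.on (S := S)).mass_nonneg z x a
    fun_prop
  have h2 : ContinuousOn S.leakJoint {p | IsChannel p} := by
    refine ContinuousOn.congr (Continuous.continuousOn ?_) fun p hp => mutualInfo_eq_negMulLog
      fun b x => (hp.on (S := S)).mass_nonneg b.2 x b.1
    fun_prop
  have h3 : Continuous S.expDistortion := by
    unfold expDistortion
    fun_prop
  exact ((h3.continuousOn.add ((h1.sub continuousOn_const).const_smul S.μ₁)).add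
    ((h2.sub continuousOn_const).const_smul S.μ₂))

/-! ### The divergence between channels -/

/-- The conditional relative entropy `D(p ‖ p' | Z, X)`, in nats. -/
noncomputable def condKL (S : Problem Rh R Z X) (p p' : Z → X → Rh → ℝ) : ℝ :=
  ∑ a, ∑ z, ∑ x, p z x a * S.pZX z x * Real.log (p z x a / p' z x a)

@[simp]
lemma condKL_self (S : Problem Rh R Z X) (p : Z → X → Rh → ℝ) : S.condKL p p = 0 := by
  refine Finset.sum_eq_zero fun a _ => Finset.sum_eq_zero fun z _ => Finset.sum_eq_zero fun x _ => ?_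
  by_cases h : p z x a = 0 <;> simp [h]

/-- The divergence dominates the squared Hellinger distance entrywise. -/
lemma IsChannelOn.hellinger_le_condKL (hp : S.IsChannelOn p) (hp' : S.IsChannelOn p')
    (hpos : S.IsPosOn p') (z : Z) (x : X) (a : Rh) :
    S.pZX z x * (√(p z x a) - √(p' z x a)) ^ 2 ≤ S.condKL p p' := by
  have h1 : ∀ a z x, p z x a * S.pZX z x - p' z x a * S.pZX z x
      + S.pZX z x * (√(p z x a) - √(p' z x a)) ^ 2 ≤
      p z x a * S.pZX z x * Real.log (p z x a / p' z x a) := fun a z x => by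
    rcases (S.pZX_nonneg z x).eq_or_lt with h | h
    · simp [← h]
    · nlinarith [mul_le_mul_of_nonneg_left (sub_add_sq_sqrt_le_mul_log_div ((hp z x h).1 a)
        ((hp' z x h).1 a) fun _ => hpos z x h a) h.le]
  have h2 := Finset.sum_le_sum fun a (_ : a ∈ Finset.univ) =>
    Finset.sum_le_sum fun z (_ : z ∈ Finset.univ) =>
    Finset.sum_le_sum fun x (_ : x ∈ Finset.univ) => h1 a z x
  simp only [Finset.sum_add_distrib, Finset.sum_sub_distrib] at h2
  have e1 := hp.sum_q₁Step
  have e2 := hp'.sum_q₁Step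
  simp only [q₁Step] at e1 e2
  rw [e1, e2, sub_self, zero_add] at h2
  have hn : ∀ a z x, 0 ≤ S.pZX z x * (√(p z x a) - √(p' z x a)) ^ 2 := fun a z x =>
    mul_nonneg (S.pZX_nonneg z x) (sq_nonneg _)
  refine le_trans ?_ h2
  calc _ ≤ ∑ x, S.pZX z x * (√(p z x a) - √(p' z x a)) ^ 2 :=
        Finset.single_le_sum (f := fun x => S.pZX z x * (√(p z x a) - √(p' z x a)) ^ 2)
          (fun x _ => hn a z x) (Finset.mem_univ x)
    _ ≤ ∑ z, ∑ x, S.pZX z x * (√(p z x a) - √(p' z x a)) ^ 2 :=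
        Finset.single_le_sum (f := fun z => ∑ x, S.pZX z x * (√(p z x a) - √(p' z x a)) ^ 2)
          (fun z _ => Finset.sum_nonneg fun x _ => hn a z x) (Finset.mem_univ z)
    _ ≤ _ := Finset.single_le_sum
          (f := fun a => ∑ z, ∑ x, S.pZX z x * (√(p z x a) - √(p' z x a)) ^ 2)
          (fun a _ => Finset.sum_nonneg fun z _ => Finset.sum_nonneg fun x _ => hn a z x)
          (Finset.mem_univ a)

lemma IsChannelOn.condKL_nonneg [Nonempty Rh] (hp : S.IsChannelOn p) (hp' : S.IsChannelOn p')
    (hpos : S.IsPosOn p') : 0 ≤ S.condKL p p' := by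
  obtain ⟨z, x, h⟩ := S.exists_pZX_pos
  exact (mul_nonneg h.le (sq_nonneg _)).trans
    (hp.hellinger_le_condKL hp' hpos z x (Classical.arbitrary Rh))

lemma IsChannelOn.eq_of_condKL_le_zero (hp : S.IsChannelOn p) (hp' : S.IsChannelOn p')
    (hpos : S.IsPosOn p') (h : S.condKL p p' ≤ 0) {z : Z} {x : X} (h0 : 0 < S.pZX z x) :
    p z x = p' z x := by
  funext a
  have h1 := (hp.hellinger_le_condKL hp' hpos z x a).trans h
  have h2 : (√(p z x a) - √(p' z x a)) ^ 2 ≤ 0 := nonpos_of_mul_nonpos_right h1 h0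
  have h3 : √(p z x a) = √(p' z x a) :=
    sub_eq_zero.1 (pow_eq_zero_iff two_ne_zero |>.1 (le_antisymm h2 (sq_nonneg _)))
  exact (Real.sqrt_inj ((hp z x h0).1 a) ((hp' z x h0).1 a)).1 h3

/-- A bound on the divergence from `p` keeps an entry away from `0` where `p` is positive. -/
lemma IsChannelOn.mass_mul_neg_log_le (hp : S.IsChannelOn p) (hp' : S.IsChannelOn p')
    (hpos : S.IsPosOn p') {z : Z} {x : X} {a : Rh} :
    p z x a * S.pZX z x * -Real.log (p' z x a) ≤
      S.condKL p p' - ∑ a, ∑ z, ∑ x, p z x a * S.pZX z x * Real.log (p z x a) := by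
  have hn : ∀ a z x, 0 ≤ p z x a * S.pZX z x * -Real.log (p' z x a) := fun a z x => by
    rcases (S.pZX_nonneg z x).eq_or_lt with h | h
    · simp [← h]
    · exact mul_nonneg (hp.mass_nonneg z x a) (neg_nonneg.2 (Real.log_nonpos
        ((hp' z x h).1 a) ((Finset.single_le_sum (fun a _ => (hp' z x h).1 a)
          (Finset.mem_univ a)).trans_eq (hp' z x h).2)))
  have e : S.condKL p p' - ∑ a, ∑ z, ∑ x, p z x a * S.pZX z x * Real.log (p z x a) =
      ∑ a, ∑ z, ∑ x, p z x a * S.pZX z x * -Real.log (p' z x a) := by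
    simp only [condKL, ← Finset.sum_sub_distrib]
    refine Finset.sum_congr rfl fun a _ => Finset.sum_congr rfl fun z _ =>
      Finset.sum_congr rfl fun x _ => ?_
    rcases (hp.mass_nonneg z x a).eq_or_lt with h | h
    · simp [← h]
    · obtain ⟨hP, ha⟩ := pos_of_mass_pos h
      rw [Real.log_div ha.ne' (hpos z x hP a).ne']
      ring
  rw [e]
  calc _ ≤ ∑ x, p z x a * S.pZX z x * -Real.log (p' z x a) :=
        Finset.single_le_sum (f := fun x => p z x a * S.pZX z x * -Real.log (p' z x a))
          (fun x _ => hn a z x) (Finset.mem_univ x)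
    _ ≤ ∑ z, ∑ x, p z x a * S.pZX z x * -Real.log (p' z x a) :=
        Finset.single_le_sum (f := fun z => ∑ x, p z x a * S.pZX z x * -Real.log (p' z x a))
          (fun z _ => Finset.sum_nonneg fun x _ => hn a z x) (Finset.mem_univ z)
    _ ≤ _ := Finset.single_le_sum
          (f := fun a => ∑ z, ∑ x, p z x a * S.pZX z x * -Real.log (p' z x a))
          (fun a _ => Finset.sum_nonneg fun z _ => Finset.sum_nonneg fun x _ => hn a z x)
          (Finset.mem_univ a)

/-! ### The update of the channel -/

lemma AuxPosOn.eta_pos [Nonempty Rh] (hq : S.AuxPosOn q) {z : Z} {x : X} (h : 0 < S.pZX z x) :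
    0 < S.eta q z x :=
  Finset.sum_pos (fun a _ => hq.weight_pos h a) Finset.univ_nonempty

lemma AuxPosOn.isPosOn_pStep [Nonempty Rh] (hq : S.AuxPosOn q) : S.IsPosOn (S.pStep q) :=
  fun _ _ h a => mul_pos (one_div_pos.2 (hq.eta_pos h)) (hq.weight_pos h a)

lemma AuxPosOn.isChannelOn_pStep [Nonempty Rh] (hq : S.AuxPosOn q) :
    S.IsChannelOn (S.pStep q) := by
  refine fun z x h => ⟨fun a => (hq.isPosOn_pStep z x h a).le, ?_⟩
  simp only [pStep, ← Finset.mul_sum]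
  exact one_div_mul_cancel (hq.eta_pos h).ne'

lemma AuxPosOn.log_pStep [Nonempty Rh] (hq : S.AuxPosOn q) {z : Z} {x : X} (h : 0 < S.pZX z x)
    (a : Rh) : (S.μ₁ + S.μ₂) * Real.log (S.pStep q z x a) =
      S.μ₁ * Real.log (q.q₁ a) + S.μ₁ * Real.log (q.q₂ a x z) + S.μ₂ * Real.log (q.q₃ z a)
        - S.dbar a z x * Real.log 2 - (S.μ₁ + S.μ₂) * Real.log (S.eta q z x) := by
  obtain ⟨h1, h2, h3⟩ := hq z x h a
  have hm := S.μ_pos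
  have he := hq.eta_pos h
  have hw := hq.weight_pos h a
  rw [pStep, Real.log_mul (by positivity) hw.ne', one_div, Real.log_inv, weight,
    Real.log_rpow (by positivity), Real.log_mul (by positivity) (by positivity),
    Real.log_mul (by positivity) (by positivity), Real.log_mul (by positivity) (by positivity),
    Real.log_rpow h1, Real.log_rpow h2, Real.log_rpow h3, Real.log_rpow (by norm_num)]
  field_simp
  ring

/-- For fixed `q`, the objective `f` is a constant plus a multiple of the divergence from the
updated channel. -/
lemma AuxPosOn.f_eq_condKL [Nonempty Rh] (hq : S.AuxPosOn q) (hp : S.IsChannelOn p) :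
    S.f p q = (S.μ₁ + S.μ₂) / Real.log 2 *
      (S.condKL p (S.pStep q) - ∑ z, ∑ x, S.pZX z x * Real.log (S.eta q z x)) + S.θ := by
  have e : ∑ z, ∑ x, S.pZX z x * Real.log (S.eta q z x) =
      ∑ a, ∑ z, ∑ x, p z x a * S.pZX z x * Real.log (S.eta q z x) := by
    rw [Finset.sum_comm (s := (Finset.univ : Finset Rh))]
    refine Finset.sum_congr rfl fun z _ => ?_
    rw [Finset.sum_comm (s := (Finset.univ : Finset Rh))]
    exact Finset.sum_congr rfl fun x _ => by rw [← Finset.sum_mul, hp.sum_mass]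
  rw [hp.f_eq_sum_log hq.compatible, e]
  congr 1
  simp only [condKL, ← Finset.sum_sub_distrib, Finset.mul_sum]
  refine Finset.sum_congr rfl fun a _ => Finset.sum_congr rfl fun z _ =>
    Finset.sum_congr rfl fun x _ => ?_
  rcases (hp.mass_nonneg z x a).eq_or_lt with h0 | h0
  · simp [← h0]
  · obtain ⟨hP, ha⟩ := pos_of_mass_pos h0
    have l2 : Real.log 2 ≠ 0 := (Real.log_pos (by norm_num)).ne'
    rw [Real.log_div ha.ne' (hq.isPosOn_pStep z x hP a).ne']
    have := hq.log_pStep hP a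
    field_simp
    linear_combination this

lemma AuxPosOn.f_eq_f_pStep_add [Nonempty Rh] (hq : S.AuxPosOn q) (hp : S.IsChannelOn p) :
    S.f p q = S.f (S.pStep q) q + (S.μ₁ + S.μ₂) / Real.log 2 * S.condKL p (S.pStep q) := by
  rw [hq.f_eq_condKL hp, hq.f_eq_condKL hq.isChannelOn_pStep, condKL_self]
  ring

lemma AuxPosOn.f_pStep_le [Nonempty Rh] (hq : S.AuxPosOn q) (hp : S.IsChannelOn p) :
    S.f (S.pStep q) q ≤ S.f p q := by
  rw [hq.f_eq_f_pStep_add hp]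
  have := hp.condKL_nonneg hq.isChannelOn_pStep hq.isPosOn_pStep
  nlinarith [mul_nonneg S.factor_pos.le this]

/-! ### Comparison with an arbitrary channel -/

/-- The loss from using the auxiliary variables of `p'` instead of those of `p` is at most a multiple
of the divergence of `p` from `p'`: the auxiliary variables are marginals and conditionals of the
joint distribution, so the chain rule and the log-sum inequality apply. -/
lemma IsChannelOn.f_qStep_sub_g_le (hp : S.IsChannelOn p) (hp' : S.IsChannelOn p')
    (hpos : S.IsPosOn p') :
    S.f p (S.qStep p') - S.g p ≤ (S.μ₁ + S.μ₂) / Real.log 2 * S.condKL p p' := by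
  have hmass : ∀ z x a, 0 < p z x a * S.pZX z x → 0 < p' z x a * S.pZX z x := fun z x a h =>
    mul_pos (hpos z x (pos_of_mass_pos h).1 a) (pos_of_mass_pos h).1
  have hlog : ∀ z x a, p z x a * S.pZX z x * Real.log (p z x a / p' z x a) =
      p z x a * S.pZX z x * Real.log (p z x a * S.pZX z x / (p' z x a * S.pZX z x)) := by
    intro z x a
    rcases (S.pZX_nonneg z x).eq_or_lt with h | h
    · simp [← h]
    · rw [mul_div_mul_right _ _ h.ne']
  have hJn : ∀ {p : Z → X → Rh → ℝ}, S.IsChannelOn p → ∀ a x, 0 ≤ ∑ z, p z x a * S.pZX z x :=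
    fun hp a x => Finset.sum_nonneg fun z _ => hp.mass_nonneg z x a
  have hWn : ∀ {p : Z → X → Rh → ℝ}, S.IsChannelOn p → ∀ z a, 0 ≤ ∑ x, p z x a * S.pZX z x :=
    fun hp z a => Finset.sum_nonneg fun x _ => hp.mass_nonneg z x a
  have hJpos : ∀ a x, 0 < ∑ z, p z x a * S.pZX z x → 0 < ∑ z, p' z x a * S.pZX z x := by
    intro a x h
    obtain ⟨z, -, hz⟩ := Finset.exists_lt_of_sum_lt (s := Finset.univ) (f := fun _ => (0 : ℝ))
      (g := fun z => p z x a * S.pZX z x) (by simpa using h)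
    exact hp'.sum_mass_Z_pos (hmass z x a hz)
  have hWpos : ∀ z a, 0 < ∑ x, p z x a * S.pZX z x → 0 < ∑ x, p' z x a * S.pZX z x := by
    intro z a h
    obtain ⟨x, -, hx⟩ := Finset.exists_lt_of_sum_lt (s := Finset.univ) (f := fun _ => (0 : ℝ))
      (g := fun x => p z x a * S.pZX z x) (by simpa using h)
    exact hp'.sum_mass_X_pos (hmass z x a hx)
  have hq₁ : ∀ (p : Z → X → Rh → ℝ) a, S.q₁Step p a = ∑ x, ∑ z, p z x a * S.pZX z x :=
    fun p a => Finset.sum_comm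
  -- the divergence of the marginals of `R̂` is at most that of the marginals of `(R̂, X)`
  have hA : ∑ a, S.q₁Step p a * (Real.log (S.q₁Step p a) - Real.log (S.q₁Step p' a)) ≤
      ∑ a, ∑ x, (∑ z, p z x a * S.pZX z x) *
        (Real.log (∑ z, p z x a * S.pZX z x) - Real.log (∑ z, p' z x a * S.pZX z x)) := by
    refine Finset.sum_le_sum fun a _ => ?_
    have key := sum_mul_log_sum_div_sum_le (hJn hp a) (hJn hp' a) (hJpos a)
    rw [← hq₁, ← hq₁] at key
    refine le_trans (le_of_eq ?_) (key.trans (le_of_eq (Finset.sum_congr rfl fun x _ => ?_)))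
    · rcases (hp.q₁Step_nonneg a).eq_or_lt with h | h
      · simp [← h]
      · rw [hq₁] at h
        obtain ⟨x, -, hx⟩ := Finset.exists_lt_of_sum_lt (s := Finset.univ)
          (f := fun _ => (0 : ℝ)) (g := fun x => ∑ z, p z x a * S.pZX z x) (by simpa using h)
        have h' : 0 < S.q₁Step p' a := by
          rw [hq₁]
          exact Finset.sum_pos' (fun x _ => hJn hp' a x) ⟨x, Finset.mem_univ x, hJpos a x hx⟩
        rw [← hq₁] at h
        rw [Real.log_div h.ne' h'.ne']
    · rcases (hJn hp a x).eq_or_lt with h | h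
      · simp [← h]
      · rw [Real.log_div h.ne' (hJpos a x h).ne']
  -- the chain rule for `Z` given `(R̂, X)`
  have hB : (∑ a, ∑ x, (∑ z, p z x a * S.pZX z x) *
        (Real.log (∑ z, p z x a * S.pZX z x) - Real.log (∑ z, p' z x a * S.pZX z x))) +
      ∑ a, ∑ x, ∑ z, p z x a * S.pZX z x *
        (Real.log (S.q₂Step p a x z) - Real.log (S.q₂Step p' a x z)) = S.condKL p p' := by
    simp only [Finset.sum_mul, ← Finset.sum_add_distrib, condKL]
    refine Finset.sum_congr rfl fun a _ => ?_
    rw [Finset.sum_comm]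
    refine Finset.sum_congr rfl fun z _ => Finset.sum_congr rfl fun x _ => ?_
    rw [hlog]
    rcases (hp.mass_nonneg z x a).eq_or_lt with h | h
    · simp [← h]
    · have h' := hmass z x a h
      have hJ := hp.sum_mass_Z_pos h
      have hJ' := hp'.sum_mass_Z_pos h'
      rw [q₂Step_eq, q₂Step_eq, Real.log_div h.ne' hJ.ne', Real.log_div h'.ne' hJ'.ne',
        Real.log_div h.ne' h'.ne']
      ring
  -- the divergence of the marginals of `(R̂, Z)` is at most that of the joint distributions
  have hC : ∑ z, ∑ a, (∑ x, p z x a * S.pZX z x) *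
      (Real.log (S.q₃Step p z a) - Real.log (S.q₃Step p' z a)) ≤ S.condKL p p' := by
    rw [condKL, Finset.sum_comm]
    refine Finset.sum_le_sum fun a _ => Finset.sum_le_sum fun z _ => ?_
    simp only [hlog]
    refine le_trans (le_of_eq ?_) (sum_mul_log_sum_div_sum_le (fun x => hp.mass_nonneg z x a)
      (fun x => hp'.mass_nonneg z x a) fun x => hmass z x a)
    rcases (hWn hp z a).eq_or_lt with h | h
    · simp [← h]
    · have h' := hWpos z a h
      obtain ⟨x, -, hx⟩ := Finset.exists_lt_of_sum_lt (s := Finset.univ) (f := fun _ => (0 : ℝ))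
        (g := fun x => p z x a * S.pZX z x) (by simpa using h)
      have hZ := pZ_pos (pos_of_mass_pos hx).1
      rw [q₃Step_eq, q₃Step_eq, Real.log_div h.ne' hZ.ne', Real.log_div h'.ne' hZ.ne',
        Real.log_div h.ne' h'.ne']
      ring
  rw [hp.g_eq_f, hp.f_sub_f (hpos.auxPosOn_qStep hp').compatible hp.compatible_qStep,
    div_mul_eq_mul_div]
  refine div_le_div_of_nonneg_right ?_ (Real.log_nonneg (by norm_num))
  have hAB := mul_le_mul_of_nonneg_left (hB ▸ add_le_add_left hA _) S.μ₁_nonneg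
  have hC' := mul_le_mul_of_nonneg_left hC S.μ₂_nonneg
  simp only [qStep]
  linarith

/-- One full iteration started at `p'`: the excess of `f` over the value of `g` at any other channel
`p` is bounded by the decrease of the divergence from `p`. -/
lemma IsChannelOn.f_iterate_sub_g_le [Nonempty Rh] (hp : S.IsChannelOn p)
    (hp' : S.IsChannelOn p') (hpos : S.IsPosOn p') :
    S.f (S.pStep (S.qStep p')) (S.qStep p') - S.g p ≤
      (S.μ₁ + S.μ₂) / Real.log 2 * (S.condKL p p' - S.condKL p (S.pStep (S.qStep p'))) := by
  have h1 := hp.f_qStep_sub_g_le hp' hpos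
  rw [(hpos.auxPosOn_qStep hp').f_eq_f_pStep_add hp] at h1
  linarith

/-! ### The iteration -/

variable [Nonempty Rh]

lemma qIter_posOn_distOn (hpos : S.AuxPosOn q0) (hdist : S.IsDistOn q0) :
    ∀ t, S.AuxPosOn (S.qIter q0 t) ∧ S.IsDistOn (S.qIter q0 t)
  | 0 => ⟨hpos, hdist⟩
  | t + 1 =>
    have h := (qIter_posOn_distOn hpos hdist t).1
    ⟨h.isPosOn_pStep.auxPosOn_qStep h.isChannelOn_pStep,
      h.isPosOn_pStep.isDistOn_qStep h.isChannelOn_pStep⟩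

/-- The value of `f` after the update of `p` cannot stay the same unless the iteration has
converged. -/
lemma iterate_converged_of_f_le (hpos : S.AuxPosOn q0) (hdist : S.IsDistOn q0) {t : ℕ}
    (h : S.f (S.pIter q0 t) (S.qIter q0 (t + 1)) ≤
      S.f (S.pIter q0 (t + 1)) (S.qIter q0 (t + 1))) :
    ∀ s, t ≤ s → S.qIter q0 (s + 1) = S.qIter q0 (t + 1) ∧
      ∀ z x, 0 < S.pZX z x → S.pIter q0 s z x = S.pIter q0 t z x := by
  have h0 := (qIter_posOn_distOn hpos hdist t).1
  have h1 := (qIter_posOn_distOn hpos hdist (t + 1)).1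
  have hK : S.condKL (S.pIter q0 t) (S.pIter q0 (t + 1)) ≤ 0 := by
    rw [h1.f_eq_f_pStep_add (p := S.pIter q0 t) h0.isChannelOn_pStep] at h
    have h' : (S.μ₁ + S.μ₂) / Real.log 2 * S.condKL (S.pIter q0 t) (S.pIter q0 (t + 1)) ≤ 0 := by
      have : S.pIter q0 (t + 1) = S.pStep (S.qIter q0 (t + 1)) := rfl
      rw [this] at h ⊢
      linarith
    exact nonpos_of_mul_nonpos_right h' S.factor_pos
  have heq : ∀ z x, 0 < S.pZX z x → S.pIter q0 (t + 1) z x = S.pIter q0 t z x :=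
    fun z x hzx => (IsChannelOn.eq_of_condKL_le_zero (p := S.pIter q0 t) h0.isChannelOn_pStep
      (p' := S.pIter q0 (t + 1)) h1.isChannelOn_pStep h1.isPosOn_pStep hK hzx).symm
  intro s hs
  induction s, hs using Nat.le_induction with
  | base => exact ⟨rfl, fun _ _ _ => rfl⟩
  | succ s _ ih =>
    have e : S.pIter q0 (s + 1) = S.pIter q0 (t + 1) := by simp only [pIter, ih.1]
    have hp : ∀ z x, 0 < S.pZX z x → S.pIter q0 (s + 1) z x = S.pIter q0 t z x := by
      rw [e]
      exact heq
    exact ⟨qStep_congr hp, hp⟩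

/-! ### Convergence to a minimiser -/

/-- A channel on the support of `(Z, X)` extends to a channel. -/
lemma IsChannelOn.exists_isChannel (hp : S.IsChannelOn p) :
    ∃ p', IsChannel p' ∧ ∀ z x, 0 < S.pZX z x → p' z x = p z x := by
  classical
  obtain ⟨r, hr⟩ := DataRelease.exists_isChannel (Rh := Rh) (Z := Z) (X := X)
  refine ⟨fun z x => if 0 < S.pZX z x then p z x else r z x, fun z x => ?_, fun z x h => if_pos h⟩
  dsimp only
  split_ifs with h
  · exact hp z x h
  · exact hr z x

lemma exists_isMinOn_g (S : Problem Rh R Z X) :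
    ∃ p, IsChannel p ∧ ∀ p', IsChannel p' → S.g p ≤ S.g p' := by
  obtain ⟨p, hp, hmin⟩ := isCompact_setOf_isChannel.exists_isMinOn
    (DataRelease.exists_isChannel (Rh := Rh) (Z := Z) (X := X)) S.continuousOn_g
  exact ⟨p, hp, fun p' hp' => hmin hp'⟩

/-- The minimum over all channels is also a lower bound for kernels that are channels only on the
support of `(Z, X)`. -/
lemma IsChannelOn.g_le_of_isMin (hmin : ∀ p', IsChannel p' → S.g p ≤ S.g p')
    (hp' : S.IsChannelOn p') : S.g p ≤ S.g p' := by
  obtain ⟨r, hr, he⟩ := hp'.exists_isChannel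
  exact (hmin r hr).trans_eq (g_congr he)

lemma g_pIter_le_f (hpos : S.AuxPosOn q0) (hdist : S.IsDistOn q0) (t : ℕ) :
    S.g (S.pIter q0 t) ≤ S.f (S.pIter q0 t) (S.qIter q0 t) := by
  have h := qIter_posOn_distOn hpos hdist t
  have hc : S.IsChannelOn (S.pIter q0 t) := h.1.isChannelOn_pStep
  rw [hc.g_eq_f]
  exact hc.f_qStep_le h.2 h.1.compatible

lemma condKL_pIter_succ_le (hpos : S.AuxPosOn q0) (hdist : S.IsDistOn q0)
    (hp : S.IsChannelOn p) (hmin : ∀ p', IsChannel p' → S.g p ≤ S.g p') (t : ℕ) :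
    S.condKL p (S.pIter q0 (t + 1)) ≤ S.condKL p (S.pIter q0 t) := by
  have h := (qIter_posOn_distOn hpos hdist t).1
  have h' := (qIter_posOn_distOn hpos hdist (t + 1)).1
  have h1 := hp.f_iterate_sub_g_le (p' := S.pIter q0 t) h.isChannelOn_pStep h.isPosOn_pStep
  have h2 := g_pIter_le_f hpos hdist (t + 1)
  have h3 := IsChannelOn.g_le_of_isMin hmin (p' := S.pIter q0 (t + 1)) h'.isChannelOn_pStep
  have h4 : 0 ≤ (S.μ₁ + S.μ₂) / Real.log 2 *
      (S.condKL p (S.pIter q0 t) - S.condKL p (S.pIter q0 (t + 1))) :=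
    (sub_nonneg.2 (h3.trans h2)).trans h1
  exact sub_nonneg.1 (nonneg_of_mul_nonneg_right h4 S.factor_pos)

/-- The iterates approach every minimiser monotonically in divergence. -/
lemma antitone_condKL_pIter (hpos : S.AuxPosOn q0) (hdist : S.IsDistOn q0)
    (hp : S.IsChannelOn p) (hmin : ∀ p', IsChannel p' → S.g p ≤ S.g p') :
    Antitone fun t => S.condKL p (S.pIter q0 t) :=
  antitone_nat_of_succ_le (condKL_pIter_succ_le hpos hdist hp hmin)

lemma tendsto_f_pIter (hpos : S.AuxPosOn q0) (hdist : S.IsDistOn q0)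
    (hp : S.IsChannelOn p) (hmin : ∀ p', IsChannel p' → S.g p ≤ S.g p') :
    Tendsto (fun t => S.f (S.pIter q0 t) (S.qIter q0 t)) atTop (𝓝 (S.g p)) := by
  have hK := tendsto_atTop_ciInf (antitone_condKL_pIter hpos hdist hp hmin)
    ⟨0, by
      rintro _ ⟨t, rfl⟩
      have h := (qIter_posOn_distOn hpos hdist t).1
      exact hp.condKL_nonneg (p' := S.pIter q0 t) h.isChannelOn_pStep h.isPosOn_pStep⟩
  have hdiff := ((hK.sub (hK.comp (tendsto_add_atTop_nat 1))).const_mul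
    ((S.μ₁ + S.μ₂) / Real.log 2)).const_add (S.g p)
  rw [sub_self, mul_zero, add_zero] at hdiff
  rw [← tendsto_add_atTop_iff_nat 1]
  refine tendsto_of_tendsto_of_tendsto_of_le_of_le tendsto_const_nhds hdiff (fun t => ?_)
    fun t => ?_
  · have h := (qIter_posOn_distOn hpos hdist (t + 1)).1
    exact (IsChannelOn.g_le_of_isMin hmin (p' := S.pIter q0 (t + 1)) h.isChannelOn_pStep).trans
      (g_pIter_le_f hpos hdist (t + 1))
  · have h := (qIter_posOn_distOn hpos hdist t).1
    have h1 := hp.f_iterate_sub_g_le (p' := S.pIter q0 t) h.isChannelOn_pStep h.isPosOn_pStep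
    exact sub_le_iff_le_add'.1 h1

lemma tendsto_g_pIter (hpos : S.AuxPosOn q0) (hdist : S.IsDistOn q0)
    (hp : S.IsChannelOn p) (hmin : ∀ p', IsChannel p' → S.g p ≤ S.g p') :
    Tendsto (fun t => S.g (S.pIter q0 t)) atTop (𝓝 (S.g p)) :=
  tendsto_of_tendsto_of_tendsto_of_le_of_le tendsto_const_nhds
    (tendsto_f_pIter hpos hdist hp hmin)
    (fun t => IsChannelOn.g_le_of_isMin hmin (p' := S.pIter q0 t)
      (qIter_posOn_distOn hpos hdist t).1.isChannelOn_pStep)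
    (g_pIter_le_f hpos hdist)

/-- Some subsequence of the iterates converges to a minimiser, by compactness; since the divergence
from that minimiser is monotone along the iteration, the whole sequence does. -/
lemma exists_isMin_tendsto_pIter (hpos : S.AuxPosOn q0) (hdist : S.IsDistOn q0) :
    ∃ p, IsChannel p ∧ (∀ p', IsChannel p' → S.g p ≤ S.g p') ∧
      ∀ z x, 0 < S.pZX z x → Tendsto (fun t => S.pIter q0 t z x) atTop (𝓝 (p z x)) := by
  obtain ⟨pm, hpm, hpmin⟩ := S.exists_isMinOn_g
  have hch : ∀ t, S.IsChannelOn (S.pIter q0 t) := fun t =>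
    (qIter_posOn_distOn hpos hdist t).1.isChannelOn_pStep
  have hps : ∀ t, S.IsPosOn (S.pIter q0 t) := fun t =>
    (qIter_posOn_distOn hpos hdist t).1.isPosOn_pStep
  choose r hr her using fun t => (hch t).exists_isChannel
  obtain ⟨p, hp, φ, hφ, hlim⟩ := isCompact_setOf_isChannel.tendsto_subseq hr
  have hg : S.g p = S.g pm := by
    have h1 : Tendsto (fun k => S.g (r (φ k))) atTop (𝓝 (S.g p)) :=
      (S.continuousOn_g p hp).tendsto.comp (tendsto_nhdsWithin_iff.2
        ⟨hlim, Eventually.of_forall fun k => hr (φ k)⟩)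
    have h2 := (tendsto_g_pIter hpos hdist hpm.on hpmin).comp hφ.tendsto_atTop
    refine tendsto_nhds_unique h1 (h2.congr fun k => ?_)
    exact (g_congr (her (φ k))).symm
  have hmin : ∀ p', IsChannel p' → S.g p ≤ S.g p' := hg ▸ hpmin
  have hcoord : ∀ z x a, 0 < S.pZX z x →
      Tendsto (fun k => S.pIter q0 (φ k) z x a) atTop (𝓝 (p z x a)) := fun z x a h => by
    have h1 := tendsto_pi_nhds.1 (tendsto_pi_nhds.1 (tendsto_pi_nhds.1 hlim z) x) a
    refine h1.congr fun k => ?_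
    simp only [Function.comp_apply, her (φ k) z x h]
  -- along the subsequence the divergence from the limit vanishes
  have hsub : Tendsto (fun k => S.condKL p (S.pIter q0 (φ k))) atTop (𝓝 0) := by
    rw [← S.condKL_self p]
    refine tendsto_finsetSum _ fun a _ => tendsto_finsetSum _ fun z _ =>
      tendsto_finsetSum _ fun x _ => ?_
    rcases ((hp.on (S := S)).mass_nonneg z x a).eq_or_lt with h | h
    · simp [← h]
    · obtain ⟨hP, ha⟩ := pos_of_mass_pos h
      exact ((tendsto_const_nhds.div (hcoord z x a hP) ha.ne').log
        (div_pos ha ha).ne').const_mul _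
  have hall : Tendsto (fun t => S.condKL p (S.pIter q0 t)) atTop (𝓝 0) :=
    (tendsto_iff_tendsto_subseq_of_antitone (antitone_condKL_pIter hpos hdist hp.on hmin)
      hφ.tendsto_atTop).2 hsub
  refine ⟨p, hp, hmin, fun z x h => tendsto_pi_nhds.2 fun a => ?_⟩
  have h1 : Tendsto (fun t => (√(p z x a) - √(S.pIter q0 t z x a)) ^ 2) atTop (𝓝 0) := by
    have h2 := hall.div_const (S.pZX z x)
    rw [zero_div] at h2
    refine squeeze_zero (fun t => sq_nonneg _) (fun t => ?_) h2
    rw [le_div_iff₀' h]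
    exact hp.on.hellinger_le_condKL (hch t) (hps t) z x a
  have h3 : Tendsto (fun t => √(p z x a) - √(S.pIter q0 t z x a)) atTop (𝓝 0) := by
    have := h1.sqrt
    simp only [Real.sqrt_sq_eq_abs, Real.sqrt_zero] at this
    exact (tendsto_zero_iff_abs_tendsto_zero _).2 this
  have h4 := ((tendsto_const_nhds (x := √(p z x a))).sub h3).pow 2
  simp only [sub_sub_cancel, sub_zero] at h4
  rw [Real.sq_sqrt ((hp z x).1 a)] at h4
  exact h4.congr fun t => Real.sq_sqrt ((hps t z x h a).le)

/-! ### The interior case -/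

/-- The divergence of the iterates from a positive minimiser stays bounded, so their limit is
positive. -/
lemma isPosOn_of_tendsto_pIter (hpos : S.AuxPosOn q0) (hdist : S.IsDistOn q0)
    (hp : S.IsChannelOn p) (hmin : ∀ p', IsChannel p' → S.g p ≤ S.g p') (hpp : S.IsPosOn p)
    (hlim : ∀ z x, 0 < S.pZX z x → Tendsto (fun t => S.pIter q0 t z x) atTop (𝓝 (p' z x))) :
    S.IsPosOn p' := by
  intro z x h a
  set C := S.condKL p (S.pIter q0 0) -
    ∑ a, ∑ z, ∑ x, p z x a * S.pZX z x * Real.log (p z x a) with hC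
  have hm : 0 < p z x a * S.pZX z x := mul_pos (hpp z x h a) h
  refine (Real.exp_pos (-(C / (p z x a * S.pZX z x)))).trans_le
    (ge_of_tendsto' (tendsto_pi_nhds.1 (hlim z x h) a) fun t => ?_)
  have hq := (qIter_posOn_distOn hpos hdist t).1
  have h1 := hp.mass_mul_neg_log_le (p' := S.pIter q0 t) hq.isChannelOn_pStep hq.isPosOn_pStep
    (z := z) (x := x) (a := a)
  have h2 := antitone_condKL_pIter hpos hdist hp hmin t.zero_le
  have h3 : p z x a * S.pZX z x * -Real.log (S.pIter q0 t z x a) ≤ C :=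
    h1.trans (sub_le_sub_right h2 _)
  refine (Real.le_log_iff_exp_le (y := S.pIter q0 t z x a) (hq.isPosOn_pStep z x h a)).1 ?_
  rw [neg_le, le_div_iff₀' hm]
  exact h3

/-- A positive minimiser is a fixed point: otherwise one more iteration would decrease `g`. -/
lemma IsChannelOn.eq_pStep_qStep (hp : S.IsChannelOn p) (hpp : S.IsPosOn p)
    (hmin : ∀ p', IsChannel p' → S.g p ≤ S.g p') {z : Z} {x : X} (h : 0 < S.pZX z x) :
    p z x = S.pStep (S.qStep p) z x := by
  have hq := hpp.auxPosOn_qStep hp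
  have hs := hq.isChannelOn_pStep
  refine hp.eq_of_condKL_le_zero hs hq.isPosOn_pStep ?_ h
  have h1 := hq.f_eq_f_pStep_add hp
  have h2 := hs.f_qStep_le (hpp.isDistOn_qStep hp) hq.compatible
  have h3 := IsChannelOn.g_le_of_isMin hmin hs
  rw [← hp.g_eq_f] at h1
  rw [← hs.g_eq_f] at h2
  have h4 : (S.μ₁ + S.μ₂) / Real.log 2 * S.condKL p (S.pStep (S.qStep p)) ≤ 0 := by linarith
  exact nonpos_of_mul_nonpos_right h4 S.factor_pos

end Problem

end DataRelease

theorem mainTheorem3 {Rh R Z X : Type*} [Fintype Rh] [Fintype R] [Fintype Z] [Fintype X]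
    (S : DataRelease.Problem Rh R Z X) (q0 : DataRelease.Aux Rh Z X)
    (hdist : q0.IsDistribution) (hpos : q0.IsPositive) :
    -- the iterates are positive distributions (at all pairs of positive probability)
    (∀ t z x, 0 < S.pZX z x →
      (S.pIter q0 t z x ∈ stdSimplex ℝ Rh ∧ ∀ a, 0 < S.pIter q0 t z x a) ∧
      ((S.qIter q0 t).q₁ ∈ stdSimplex ℝ Rh ∧ ∀ a, 0 < (S.qIter q0 t).q₁ a) ∧
      (∀ a, (S.qIter q0 t).q₂ a x ∈ stdSimplex ℝ Z ∧ 0 < (S.qIter q0 t).q₂ a x z) ∧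
      ((S.qIter q0 t).q₃ z ∈ stdSimplex ℝ Rh ∧ ∀ a, 0 < (S.qIter q0 t).q₃ z a)) ∧
    -- no update step increases `f`
    (∀ t,
      S.f (S.pIter q0 t)
          ⟨(S.qIter q0 (t + 1)).q₁, (S.qIter q0 t).q₂, (S.qIter q0 t).q₃⟩
        ≤ S.f (S.pIter q0 t) (S.qIter q0 t) ∧
      S.f (S.pIter q0 t)
          ⟨(S.qIter q0 (t + 1)).q₁, (S.qIter q0 (t + 1)).q₂, (S.qIter q0 t).q₃⟩
        ≤ S.f (S.pIter q0 t)
          ⟨(S.qIter q0 (t + 1)).q₁, (S.qIter q0 t).q₂, (S.qIter q0 t).q₃⟩ ∧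
      S.f (S.pIter q0 t) (S.qIter q0 (t + 1))
        ≤ S.f (S.pIter q0 t)
          ⟨(S.qIter q0 (t + 1)).q₁, (S.qIter q0 (t + 1)).q₂, (S.qIter q0 t).q₃⟩ ∧
      S.f (S.pIter q0 (t + 1)) (S.qIter q0 (t + 1))
        ≤ S.f (S.pIter q0 t) (S.qIter q0 (t + 1))) ∧
    Antitone (fun t => S.f (S.pIter q0 t) (S.qIter q0 t)) ∧
    Antitone (fun t => S.f (S.pIter q0 t) (S.qIter q0 (t + 1))) ∧
    -- the decrease is strict unless the iteration has converged
    (∀ t,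
      (S.f (S.pIter q0 (t + 1)) (S.qIter q0 (t + 1)) < S.f (S.pIter q0 t) (S.qIter q0 t) ∧
        S.f (S.pIter q0 (t + 1)) (S.qIter q0 (t + 2))
          < S.f (S.pIter q0 t) (S.qIter q0 (t + 1))) ∨
      ∀ s, t ≤ s → S.qIter q0 (s + 1) = S.qIter q0 (t + 1) ∧
        ∀ z x, 0 < S.pZX z x → S.pIter q0 s z x = S.pIter q0 t z x) ∧
    -- lower bounds
    (∀ p : Z → X → Rh → ℝ, DataRelease.IsChannel p → -(S.μ₁ * S.ε + S.μ₂ * S.δ) ≤ S.g p) ∧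
    (∀ (p : Z → X → Rh → ℝ) (q : DataRelease.Aux Rh Z X),
      DataRelease.IsChannel p → q.IsDistribution →
      (∀ z x a, 0 < S.pZX z x → 0 < p z x a → 0 < q.q₁ a ∧ 0 < q.q₂ a x z ∧ 0 < q.q₃ z a) →
      -(S.μ₁ * S.ε + S.μ₂ * S.δ) ≤ S.f p q) ∧
    (∀ t, -(S.μ₁ * S.ε + S.μ₂ * S.δ) ≤ S.f (S.pIter q0 t) (S.qIter q0 t) ∧
      -(S.μ₁ * S.ε + S.μ₂ * S.δ) ≤ S.f (S.pIter q0 t) (S.qIter q0 (t + 1))) ∧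
    -- after each iteration the value of `f` is the value of `g`
    (∀ t, S.g (S.pIter q0 t) = S.f (S.pIter q0 t) (S.qIter q0 (t + 1))) ∧
    -- convergence to the global minimum
    (∃ pstar : Z → X → Rh → ℝ,
      DataRelease.IsChannel pstar ∧
      (∀ p : Z → X → Rh → ℝ, DataRelease.IsChannel p → S.g pstar ≤ S.g p) ∧
      Filter.Tendsto (fun T => S.g (S.pIter q0 T)) Filter.atTop (nhds (S.g pstar)) ∧
      Filter.Tendsto (fun T => S.f (S.pIter q0 T) (S.qIter q0 T)) Filter.atTop
        (nhds (S.g pstar)) ∧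
      (∀ z x, 0 < S.pZX z x →
        Filter.Tendsto (fun T => S.pIter q0 T z x) Filter.atTop (nhds (pstar z x))) ∧
      -- interior case: the limit is then interior and solves the self-consistency equation
      ((∃ p₁ : Z → X → Rh → ℝ, DataRelease.IsChannel p₁ ∧
          (∀ z x, 0 < S.pZX z x → ∀ a, 0 < p₁ z x a) ∧
          ∀ p : Z → X → Rh → ℝ, DataRelease.IsChannel p → S.g p₁ ≤ S.g p) →
        ∀ z x, 0 < S.pZX z x →
          (∀ a, 0 < pstar z x a) ∧ pstar z x = S.pStep (S.qStep pstar) z x)) := by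
  have hq0 : S.AuxPosOn q0 := fun z x _ a => ⟨hpos.1 a, hpos.2.1 a x z, hpos.2.2 z a⟩
  have hd0 : S.IsDistOn q0 := fun z x _ => ⟨hdist.1, fun a => hdist.2.1 a x, hdist.2.2 z⟩
  have : Nonempty Rh := by
    by_contra h
    rw [not_nonempty_iff] at h
    simpa using hdist.1.2
  have hQ := fun t => (DataRelease.Problem.qIter_posOn_distOn hq0 hd0 t).1
  have hD := fun t => (DataRelease.Problem.qIter_posOn_distOn hq0 hd0 t).2
  have hC : ∀ t, S.IsChannelOn (S.pIter q0 t) := fun t => (hQ t).isChannelOn_pStep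
  have hP : ∀ t, S.IsPosOn (S.pIter q0 t) := fun t => (hQ t).isPosOn_pStep
  have hsteps := fun t => (hC t).f_steps (hD t) (hQ t).compatible
  have hq : ∀ t, S.f (S.pIter q0 t) (S.qIter q0 (t + 1)) ≤ S.f (S.pIter q0 t) (S.qIter q0 t) :=
    fun t => (hC t).f_qStep_le (hD t) (hQ t).compatible
  have hp : ∀ t, S.f (S.pIter q0 (t + 1)) (S.qIter q0 (t + 1)) ≤
      S.f (S.pIter q0 t) (S.qIter q0 (t + 1)) := fun t => (hQ (t + 1)).f_pStep_le (hC t)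
  refine ⟨fun t z x h => ?_, fun t => ?_, ?_, ?_, fun t => ?_, fun p h => h.on.lower_bound_g,
    fun p q h h' hc => ?_, fun t => ⟨(hC t).lower_bound_f (hD t) (hQ t).compatible,
      (hC t).lower_bound_f (hD (t + 1)) (hQ (t + 1)).compatible⟩, fun t => (hC t).g_eq_f, ?_⟩
  · have hDt := hD t z x h
    have hQt := hQ t z x h
    exact ⟨⟨hC t z x h, hP t z x h⟩, ⟨hDt.1, fun a => (hQt a).1⟩,
      fun a => ⟨hDt.2.1 a, (hQt a).2.1⟩, hDt.2.2, fun a => (hQt a).2.2⟩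
  · exact ⟨(hsteps t).1, (hsteps t).2.1, (hsteps t).2.2, hp t⟩
  · exact antitone_nat_of_succ_le fun t => (hp t).trans (hq t)
  · exact antitone_nat_of_succ_le fun t => (hq (t + 1)).trans (hp t)
  -- a strict decrease at the update of `p` is shared by both sequences of values of `f`
  · by_cases h : S.f (S.pIter q0 t) (S.qIter q0 (t + 1)) ≤
        S.f (S.pIter q0 (t + 1)) (S.qIter q0 (t + 1))
    · exact Or.inr (DataRelease.Problem.iterate_converged_of_f_le hq0 hd0 h)
    · exact Or.inl ⟨(not_le.1 h).trans_le (hq t), (hq (t + 1)).trans_lt (not_le.1 h)⟩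
  · exact h.on.lower_bound_f (fun z x _ => ⟨h'.1, fun a => h'.2.1 a x, h'.2.2 z⟩)
      fun z x a h1 h2 => hc z x a h1 h2
  · obtain ⟨pstar, hch, hmin, hlim⟩ :=
      DataRelease.Problem.exists_isMin_tendsto_pIter hq0 hd0
    refine ⟨pstar, hch, hmin, DataRelease.Problem.tendsto_g_pIter hq0 hd0 hch.on hmin,
      DataRelease.Problem.tendsto_f_pIter hq0 hd0 hch.on hmin, hlim, ?_⟩
    rintro ⟨p₁, h₁, hpos₁, hmin₁⟩ z x h
    have hps := DataRelease.Problem.isPosOn_of_tendsto_pIter hq0 hd0 h₁.on hmin₁ hpos₁ hlim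
    exact ⟨hps z x h, hch.on.eq_pStep_qStep hps hmin h⟩
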